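/- Let $d\ge 1$, $p\ge 0$, $\Theta=[\theta_{\inf},\theta_{\sup}]^p$ and $\theta_0\in\Theta$ with $\theta_{\inf}<(\theta_0)_i<\theta_{\sup}$ for $1\le i\le p$. Let $\{K_\theta,\theta\in\Theta\}$ be functions $K_\theta:\mathbb{R}^d\to\mathbb{R}$ such that: (a) each $K_\theta$ is a stationary covariance function, that is, every matrix $(K_\theta(t_i-t_j))_{i,j}$ with $t_1,\dots,t_m\in\mathbb{R}^d$ is symmetric positive semidefinite; (b) $K_\theta(t)$ has all its partial derivatives in $\theta$ up to order three on $\Theta$ (one-sided at the boundary), and for all $q\in\{0,\dots,3\}$ and $i_1,\dots,i_q\in\{1,\dots,p\}$ there is $C_{i_1,\dots,i_q}<\infty$ such that $\left|\frac{\partial}{\partial\theta_{i_1}}\cdots\frac{\partial}{\partial\theta_{i_q}}K_\theta(t)\right|\le \frac{C_{i_1,\dots,i_q}}{1+|t|^{d+1}}$ for all $\theta\in\Theta$, $t\in\mathbb{R}^d$, with $|\cdot|$ the Euclidean norm; (c) with $\hat K_\theta(f)=\frac{1}{(2\pi)^d}\int_{\mathbb{R}^d}K_\theta(t)e^{-\mathrm{i}f\cdot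 t}\,dt$, the function $\hat K_\theta$ is integrable and $K_\theta(t)=\int_{\mathbb{R}^d}\hat K_\theta(f)e^{\mathrm{i}f\cdot t}\,df$ for all $\theta\in\Theta$ and $t\in\mathbb{R}^d$, and $(f,\theta)\mapsto\hat K_\theta(f)$ is continuous and positive on $\mathbb{R}^d\times\Theta$; (d) $K_\theta(0)=1$ for all $\theta\in\Theta$. Let $(v_i)_{i\ge1}$ be a sequence of points with positive integer coordinates such that $\{v_i:1\le i\le N^d\}=\{1,\dots,N\}^d$ for all $N\ge1$, let $\epsilon\in[0,\frac12)$, and let $(X_i)_{i\ge1}$ be i.i.d. with a law $\mathcal{L}_X$ that is symmetric, has (topological) support $S_X\subset[-1,1]^d$, and has a probability density that is positive on $S_X$. For $n\ge 1$ let $R$ and $\frac{\partial R}{\partial\theta_k}$ be the $n\times n$ matrices with entries $K_{\theta_0}(v_i-v_j+\epsilon(X_i-X_j))$ and $\frac{\partial}{\partial\theta_k}K_{\theta_0}(v_i-v_j+\epsilon(X_i-X_j))$, let $\operatorname{diag}(A)$ be the matrix $A$ with its off-diagonal entries set to $0$, and let $$\begin{aligned}M_{CV,2}^{i,j}={}&-8\operatorname{diag}(R^{-1})^{-3}\operatorname{diag}\!\left(R^{-1}\tfrac{\partial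 R}{\partial\theta_i}R^{-1}\right)R^{-1}\tfrac{\partial R}{\partial\theta_j}R^{-1}+2\operatorname{diag}(R^{-1})^{-2}R^{-1}\tfrac{\partial R}{\partial\theta_i}R^{-1}\tfrac{\partial R}{\partial\theta_j}R^{-1}\\&+6\operatorname{diag}(R^{-1})^{-4}\operatorname{diag}\!\left(R^{-1}\tfrac{\partial R}{\partial\theta_i}R^{-1}\right)\operatorname{diag}\!\left(R^{-1}\tfrac{\partial R}{\partial\theta_j}R^{-1}\right)R^{-1}.\end{aligned}$$ Then there is a (necessarily unique) deterministic $p\times p$ matrix $\Sigma_{CV,2}$ such that, for all $1\le i,j\le p$, $\frac1n\operatorname{Tr}(M_{CV,2}^{i,j})\to(\Sigma_{CV,2})_{i,j}$ almost surely as $n\to\infty$, and: 1. For $\epsilon=0$: if there is no $(\lambda_1,\dots,\lambda_p)\in\mathbb{R}^p$, different from zero, such that $\sum_{k=1}^p\lambda_k\frac{\partial}{\partial\theta_k}K_{\theta_0}(v)=0$ for all $v\in\mathbb{Z}^d$, then $\Sigma_{CV,2}$ is (symmetric) positive definite. 2. For $\epsilon\ne0$, let $D_\epsilon=\bigcup_{v\in\mathbb{Z}^d\setminus\{0\}}(v+\epsilon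 C_{S_X})$ with $C_{S_X}=\{t_1-t_2:t_1,t_2\in S_X\}$. If there is no $(\lambda_1,\dots,\lambda_p)\in\mathbb{R}^p$, different from zero, such that $\sum_{k=1}^p\lambda_k\frac{\partial}{\partial\theta_k}K_{\theta_0}(t)=0$ for Lebesgue-almost every $t\in D_\epsilon$, then $\Sigma_{CV,2}$ is (symmetric) positive definite. -/

import Mathlib

open MeasureTheory ProbabilityTheory Filter Topology
open scoped Matrix

noncomputable section

namespace CrossValidation

/-- `ℝ^d` with its Euclidean norm and Lebesgue measure. -/
abbrev E (d : ℕ) := EuclideanSpace ℝ (Fin d)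

/-- The parameter set `Θ = [θinf, θsup]^p`. -/
def paramBox (p : ℕ) (θinf θsup : ℝ) : Set (Fin p → ℝ) :=
  {θ | ∀ i, θ i ∈ Set.Icc θinf θsup}

/-- The partial derivative `∂g/∂θ_i` of a function on the box `[θinf, θsup]^p`
(one-sided on the faces of the box, the usual one where `θinf < θ_i < θsup`). -/
def partialDeriv {p : ℕ} (θinf θsup : ℝ) (i : Fin p) (g : (Fin p → ℝ) → ℝ) :
    (Fin p → ℝ) → ℝ :=
  fun θ => derivWithin (fun s => g (Function.update θ i s)) (Set.Icc θinf θsup) (θ i)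

/-- Existence of the partial derivative `∂g/∂θ_i` at `θ` (relative to the box). -/
def HasPartialAt {p : ℕ} (θinf θsup : ℝ) (i : Fin p) (g : (Fin p → ℝ) → ℝ)
    (θ : Fin p → ℝ) : Prop :=
  DifferentiableWithinAt ℝ (fun s => g (Function.update θ i s)) (Set.Icc θinf θsup) (θ i)

/-- The iterated partial derivative `∂/∂θ_{i_1} ⋯ ∂/∂θ_{i_q} g`, for the list `[i_1, …, i_q]`. -/
def iterPartial {p : ℕ} (θinf θsup : ℝ) (l : List (Fin p)) (g : (Fin p → ℝ) → ℝ) :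
    (Fin p → ℝ) → ℝ :=
  l.foldr (fun i h => partialDeriv θinf θsup i h) g

/-- `k` is the covariance function of a stationary process on `ℝ^d`: all the matrices
`(k (t_i - t_j))_{i,j}` are symmetric positive semidefinite. -/
def IsStationaryCovariance {d : ℕ} (k : E d → ℝ) : Prop :=
  ∀ (n : ℕ) (t : Fin n → E d), (Matrix.of fun i j => k (t i - t j)).PosSemidef

/-- The Fourier transform `ĥ(f) = (2π)^{-d} ∫ h(t) e^{-i f·t} dt`. -/
def fourierHat {d : ℕ} (h : E d → ℝ) (f : E d) : ℂ :=
  ((1 / (2 * Real.pi) ^ d : ℝ) : ℂ) *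
    ∫ t : E d, (h t : ℂ) * Complex.exp (-(Complex.I * ((inner ℝ f t : ℝ) : ℂ)))

/-- The standing condition on the parametric model `{K_θ, θ ∈ Θ}`. -/
structure ModelCondition (d p : ℕ) (θinf θsup : ℝ) (K : (Fin p → ℝ) → E d → ℝ) : Prop where
  stationary : ∀ θ ∈ paramBox p θinf θsup, IsStationaryCovariance (K θ)
  /-- `K_θ(t)` has all its partial derivatives in `θ` up to order three. -/
  differentiable : ∀ l : List (Fin p), l.length ≤ 2 → ∀ i : Fin p,
    ∀ θ ∈ paramBox p θinf θsup, ∀ t : E d,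
      HasPartialAt θinf θsup i (iterPartial θinf θsup l (fun η => K η t)) θ
  decay : ∀ l : List (Fin p), l.length ≤ 3 → ∃ C : ℝ,
    ∀ θ ∈ paramBox p θinf θsup, ∀ t : E d,
      |iterPartial θinf θsup l (fun η => K η t) θ| ≤ C / (1 + ‖t‖ ^ (d + 1))
  integrable_hat : ∀ θ ∈ paramBox p θinf θsup, Integrable (fourierHat (K θ))
  inversion : ∀ θ ∈ paramBox p θinf θsup, ∀ t : E d,
    (K θ t : ℂ) =
      ∫ f : E d, fourierHat (K θ) f * Complex.exp (Complex.I * ((inner ℝ f t : ℝ) : ℂ))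
  continuous_hat : ContinuousOn (fun q : E d × (Fin p → ℝ) => fourierHat (K q.2) q.1)
    (Set.univ ×ˢ paramBox p θinf θsup)
  positive_hat : ∀ θ ∈ paramBox p θinf θsup, ∀ f : E d,
    (fourierHat (K θ) f).im = 0 ∧ 0 < (fourierHat (K θ) f).re

/-- `v 0, v 1, …` enumerates the positive integer grid so that, for every `N ≥ 1`, the first
`N ^ d` points are those of `{1, …, N}^d`. -/
def IsGridEnumeration {d : ℕ} (v : ℕ → Fin d → ℕ) : Prop :=
  ∀ N : ℕ, 1 ≤ N → v '' Set.Iio (N ^ d) = {u | ∀ k, 1 ≤ u k ∧ u k ≤ N}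

/-- The condition on the law of the perturbations: a symmetric probability distribution whose
(topological) support lies in `[-1,1]^d`, with a density that is positive on this support. -/
structure PerturbationLaw {d : ℕ} (L : Measure (E d)) : Prop where
  isProbability : IsProbabilityMeasure L
  symmetric : L.map (fun x => -x) = L
  support_subset : L.support ⊆ {x | ∀ k, |x k| ≤ 1}
  density : ∃ f : E d → ENNReal, Measurable f ∧ L = volume.withDensity f ∧
    ∀ x ∈ L.support, 0 < f x

/-- An integer vector as a point of `ℝ^d`. -/
def latticePoint {d : ℕ} (v : Fin d → ℤ) : E d := WithLp.toLp 2 fun k => (v k : ℝ)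

/-- The observation point `v_i + ε x_i`. -/
def obsPoint {d : ℕ} (v : ℕ → Fin d → ℕ) (ε : ℝ) (x : ℕ → E d) (i : ℕ) : E d :=
  latticePoint (fun k => (v i k : ℤ)) + ε • x i

/-- The `n × n` matrix `R_θ = (K_θ(v_i - v_j + ε (x_i - x_j)))_{i,j}`. -/
def covMatrix {d p : ℕ} (K : (Fin p → ℝ) → E d → ℝ) (v : ℕ → Fin d → ℕ) (ε : ℝ)
    (x : ℕ → E d) (n : ℕ) (θ : Fin p → ℝ) : Matrix (Fin n) (Fin n) ℝ :=
  Matrix.of fun i j => K θ (obsPoint v ε x i - obsPoint v ε x j)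

/-- The `n × n` matrix `∂R_θ/∂θ_k`, the derivative being taken entrywise. -/
def dCovMatrix {d p : ℕ} (θinf θsup : ℝ) (K : (Fin p → ℝ) → E d → ℝ) (v : ℕ → Fin d → ℕ)
    (ε : ℝ) (x : ℕ → E d) (n : ℕ) (θ : Fin p → ℝ) (k : Fin p) : Matrix (Fin n) (Fin n) ℝ :=
  Matrix.of fun i j => partialDeriv θinf θsup k (fun η => covMatrix K v ε x n η i j) θ

/-- `diag(A)`: the matrix `A` with its off-diagonal entries set to zero. -/
def diagPart {n : ℕ} (A : Matrix (Fin n) (Fin n) ℝ) : Matrix (Fin n) (Fin n) ℝ :=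
  Matrix.diagonal A.diag

/-- The matrix `M_{CV,2}^{i,j}` built from `R` and from its derivatives `Ri`, `Rj`. -/
def cvHessianOf {n : ℕ} (R Ri Rj : Matrix (Fin n) (Fin n) ℝ) : Matrix (Fin n) (Fin n) ℝ :=
  (-8 : ℝ) • ((diagPart R⁻¹)⁻¹ ^ 3 * diagPart (R⁻¹ * Ri * R⁻¹) * (R⁻¹ * Rj * R⁻¹))
  + (2 : ℝ) • ((diagPart R⁻¹)⁻¹ ^ 2 * (R⁻¹ * Ri * R⁻¹ * Rj * R⁻¹))
  + (6 : ℝ) • ((diagPart R⁻¹)⁻¹ ^ 4 * diagPart (R⁻¹ * Ri * R⁻¹) * diagPart (R⁻¹ * Rj * R⁻¹)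
      * R⁻¹)

/-- `M_{CV,2}^{i,j}` at `θ0` for the first `n` observation points. -/
def cvHessian {d p : ℕ} (θinf θsup : ℝ) (K : (Fin p → ℝ) → E d → ℝ) (v : ℕ → Fin d → ℕ)
    (ε : ℝ) (x : ℕ → E d) (n : ℕ) (θ0 : Fin p → ℝ) (i j : Fin p) :
    Matrix (Fin n) (Fin n) ℝ :=
  cvHessianOf (covMatrix K v ε x n θ0) (dCovMatrix θinf θsup K v ε x n θ0 i)
    (dCovMatrix θinf θsup K v ε x n θ0 j)

/-- `S` is the deterministic matrix `Σ_{CV,2}`: its entries are the almost sure limits of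
`(1/n) Tr(M_{CV,2}^{i,j})`. There is at most one such matrix. -/
def IsSigmaCV2 {d p : ℕ} {Ω : Type*} [MeasurableSpace Ω] (P : Measure Ω) (θinf θsup : ℝ)
    (K : (Fin p → ℝ) → E d → ℝ) (v : ℕ → Fin d → ℕ) (ε : ℝ) (X : ℕ → Ω → E d)
    (θ0 : Fin p → ℝ) (S : Matrix (Fin p) (Fin p) ℝ) : Prop :=
  ∀ i j, ∀ᵐ ω ∂P, Tendsto
    (fun n : ℕ =>
      (1 / (n : ℝ)) * (cvHessian θinf θsup K v ε (fun m => X m ω) n θ0 i j).trace)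
    atTop (𝓝 (S i j))

/-- `∑_k λ_k (∂/∂θ_k) K_{θ0}(t)`. -/
def derivComb {d p : ℕ} (θinf θsup : ℝ) (K : (Fin p → ℝ) → E d → ℝ) (θ0 : Fin p → ℝ)
    (lam : Fin p → ℝ) (t : E d) : ℝ :=
  ∑ k, lam k * partialDeriv θinf θsup k (fun η => K η t) θ0

/-- `D_ε = ⋃_{v ∈ ℤ^d, v ≠ 0} (v + ε C_S)`, where `C_S = {t₁ - t₂ : t₁, t₂ ∈ S}`. -/
def diffSet {d : ℕ} (ε : ℝ) (S : Set (E d)) : Set (E d) :=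
  {t | ∃ v : Fin d → ℤ, v ≠ 0 ∧ ∃ t₁ ∈ S, ∃ t₂ ∈ S, t = latticePoint v + ε • (t₁ - t₂)}

end CrossValidation

end

/-! With `a = (R⁻¹)_{ll}`, `b = (R⁻¹GR⁻¹)_{ll}`, `b' = (R⁻¹HR⁻¹)_{ll}` and `c = (R⁻¹GR⁻¹HR⁻¹)_{ll}`,
the trace is the sum over `l` of `2c/a² - 2bb'/a³` (`trace_cvHessianOf`). Everything rests on bounds
uniform in `n`. Since `ε < 1/2`, the points stay separated, so the decay of order `d + 1` bounds the
operator norms by Schur's test. A continuous positive spectral density dominates a small multiple of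
a wide bump, whose Gram matrix on separated points is diagonally dominant, so `R` is uniformly
coercive (`exists_coercive`).

Convergence: these matrices almost commute with multiplication by a slowly varying cutoff, and so
does `R⁻¹` by coercivity. Hence the `l`-th term is, up to `η`, a fixed function of the perturbations
in a window around `v_l` (`hessTerm_local`, `UniformBounds.exists_local`). Windows far apart are
independent and a vanishing proportion of indices is near the boundary, so a law of large numbers
applies (`ae_tendsto_localAverage`). Letting `η → 0` gives a deterministic limit
(`exists_ae_tendsto`).

Positivity: for `G = ∑ λ_k ∂_k R` the term is `(2/a²)(c - b²/a)`, a Schur complement, which is the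
`R⁻¹`-energy of the part of `G R⁻¹ e_l` orthogonal to `e_l`. As `R` has unit diagonal and `G` zero
diagonal, the sum of these energies controls the squared Frobenius norm of `G` (`sum_hessTerm_ge`).
Keeping one offset `u` and averaging bounds the limit form below by a multiple of `E[f(u + ε(X -
X'))²]`, where `f = ∑ λ_k ∂_k K` and `X`, `X'` are independent. This is positive as soon as the
continuous `f` is nonzero at one attainable difference (`UniformBounds.form_pos`). -/

namespace CrossValidation

/-! ### Operator bounds, commutators and truncation of finite matrices. -/

section FiniteMatrices

variable {ι β : Type*} [Fintype ι] [Fintype β]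

/-- The Euclidean norm of a finite family of reals. -/
noncomputable def l2 (y : ι → ℝ) : ℝ := ‖(WithLp.toLp 2 y : EuclideanSpace ℝ ι)‖

lemma l2_nonneg (y : ι → ℝ) : 0 ≤ l2 y := norm_nonneg _

lemma l2_sq (y : ι → ℝ) : l2 y ^ 2 = ∑ i, y i ^ 2 := by
  simp [l2, EuclideanSpace.norm_sq_eq]

lemma l2_add_le (y z : ι → ℝ) : l2 (y + z) ≤ l2 y + l2 z := by
  simpa [l2] using norm_add_le (WithLp.toLp 2 y : EuclideanSpace ℝ ι) (WithLp.toLp 2 z)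

lemma l2_sub_le (y z : ι → ℝ) : l2 (y - z) ≤ l2 y + l2 z := by
  simpa [l2] using norm_sub_le (WithLp.toLp 2 y : EuclideanSpace ℝ ι) (WithLp.toLp 2 z)

lemma l2_zero : l2 (0 : ι → ℝ) = 0 := by simp [l2]

lemma l2_le_of_sq_le {y : ι → ℝ} {b : ℝ} (hb : 0 ≤ b) (h : ∑ i, y i ^ 2 ≤ b ^ 2) : l2 y ≤ b := by
  rw [← l2_sq] at h
  exact le_of_sq_le_sq h hb

lemma l2_mono {y z : ι → ℝ} (h : ∀ i, |y i| ≤ |z i|) : l2 y ≤ l2 z := by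
  refine l2_le_of_sq_le (l2_nonneg z) ?_
  rw [l2_sq]
  exact Finset.sum_le_sum fun i _ => sq_le_sq.2 (h i)

lemma abs_apply_le_l2 (y : ι → ℝ) (i : ι) : |y i| ≤ l2 y := by
  simpa [l2] using PiLp.norm_apply_le (WithLp.toLp 2 y : EuclideanSpace ℝ ι) i

lemma l2_single [DecidableEq ι] (i : ι) : l2 (Pi.single i (1 : ℝ)) = 1 := by
  have h : l2 (Pi.single i (1 : ℝ)) ^ 2 = 1 := by
    rw [l2_sq, Finset.sum_eq_single i] <;> simp +contextual
  nlinarith [l2_nonneg (Pi.single i (1 : ℝ))]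

lemma dotProduct_le_l2 (y z : ι → ℝ) : y ⬝ᵥ z ≤ l2 y * l2 z := by
  have h := real_inner_le_norm (WithLp.toLp 2 z : EuclideanSpace ℝ ι) (WithLp.toLp 2 y)
  rw [EuclideanSpace.inner_eq_star_dotProduct] at h
  simpa [l2, mul_comm] using h

/-- `Q` has operator norm at most `C` on `ℓ²`. -/
def OpBound (C : ℝ) (Q : Matrix ι ι ℝ) : Prop := ∀ y, l2 (Q *ᵥ y) ≤ C * l2 y

/-- The commutator of `Q` with the multiplication by `w` has operator norm at most `δ`. -/
def CommBound (w : ι → ℝ) (δ : ℝ) (Q : Matrix ι ι ℝ) : Prop :=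
  ∀ y, l2 (w * (Q *ᵥ y) - Q *ᵥ (w * y)) ≤ δ * l2 y

/-- The quadratic form of `R` is bounded below by `c`. -/
def Coercive (c : ℝ) (R : Matrix ι ι ℝ) : Prop := ∀ y, c * l2 y ^ 2 ≤ y ⬝ᵥ R *ᵥ y

/-- Schur's test. -/
lemma opBound_of_row_col {Q q : Matrix ι ι ℝ} {C : ℝ} (hC : 0 ≤ C)
    (hq : ∀ i j, |Q i j| ≤ q i j) (hrow : ∀ i, ∑ j, q i j ≤ C) (hcol : ∀ j, ∑ i, q i j ≤ C) :
    OpBound C Q := by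
  intro y
  have hq0 : ∀ i j, 0 ≤ q i j := fun i j => (abs_nonneg _).trans (hq i j)
  refine l2_le_of_sq_le (mul_nonneg hC (l2_nonneg y)) ?_
  have h1 : ∀ i, (Q *ᵥ y) i ^ 2 ≤ C * ∑ j, q i j * y j ^ 2 := by
    intro i
    -- Cauchy–Schwarz after splitting `q` as `√q · √q`.
    have h2 : (∑ j, Q i j * y j) ^ 2 ≤ (∑ j, q i j) * ∑ j, q i j * y j ^ 2 := by
      refine Finset.sum_sq_le_sum_mul_sum_of_sq_le_mul _ (fun j _ => hq0 i j)
        (fun j _ => mul_nonneg (hq0 i j) (sq_nonneg _)) fun j _ => ?_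
      have : Q i j ^ 2 ≤ q i j ^ 2 := sq_le_sq.2 ((hq i j).trans (le_abs_self _))
      nlinarith [sq_nonneg (y j)]
    exact h2.trans (mul_le_mul_of_nonneg_right (hrow i)
      (Finset.sum_nonneg fun j _ => mul_nonneg (hq0 i j) (sq_nonneg _)))
  calc ∑ i, (Q *ᵥ y) i ^ 2 ≤ ∑ i, C * ∑ j, q i j * y j ^ 2 := Finset.sum_le_sum fun i _ => h1 i
    _ = C * ∑ j, (∑ i, q i j) * y j ^ 2 := by
      rw [← Finset.mul_sum, Finset.sum_comm]
      simp_rw [Finset.sum_mul]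
    _ ≤ C * ∑ j, C * y j ^ 2 := by
      gcongr with j
      exact hcol j
    _ = (C * l2 y) ^ 2 := by
      rw [← Finset.mul_sum, mul_pow, l2_sq]; ring

/-- The commutator has entries `(w i - w j) * Q i j`, so Schur's test applies to it. -/
lemma commBound_of_row_col {Q q : Matrix ι ι ℝ} {w : ι → ℝ} {δ : ℝ} (hδ : 0 ≤ δ)
    (hq : ∀ i j, |(w i - w j) * Q i j| ≤ q i j) (hrow : ∀ i, ∑ j, q i j ≤ δ)
    (hcol : ∀ j, ∑ i, q i j ≤ δ) : CommBound w δ Q := by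
  intro y
  have h := opBound_of_row_col (Q := Matrix.of fun i j => (w i - w j) * Q i j) hδ hq hrow hcol y
  convert h using 2
  ext i
  simp only [Pi.sub_apply, Pi.mul_apply, Matrix.mulVec, dotProduct, Matrix.of_apply]
  rw [Finset.mul_sum, ← Finset.sum_sub_distrib]
  exact Finset.sum_congr rfl fun j _ => by ring

lemma Coercive.le_l2_mulVec {R : Matrix ι ι ℝ} {c : ℝ} (hc : 0 < c) (hR : Coercive c R) (y : ι → ℝ) :
    l2 y ≤ c⁻¹ * l2 (R *ᵥ y) := by
  have h := (hR y).trans (dotProduct_le_l2 _ _)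
  rw [← div_eq_inv_mul, le_div_iff₀ hc]
  rcases (l2_nonneg y).eq_or_lt with h0 | h0
  · rw [← h0]; simpa using l2_nonneg _
  · nlinarith

section Inverse

variable [DecidableEq ι] {R : Matrix ι ι ℝ} {c C : ℝ}

lemma Coercive.isUnit_det (hc : 0 < c) (hR : Coercive c R) : IsUnit R.det := by
  rw [← Matrix.isUnit_iff_isUnit_det, ← Matrix.mulVec_injective_iff_isUnit]
  intro x y hxy
  have h := hR (x - y)
  have h0 : R *ᵥ (x - y) = 0 := by
    rw [Matrix.mulVec_sub, sub_eq_zero]; exact hxy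
  rw [h0, dotProduct_zero] at h
  have h1 : l2 (x - y) ^ 2 = 0 := le_antisymm (by nlinarith) (sq_nonneg _)
  rw [l2_sq, Finset.sum_eq_zero_iff_of_nonneg fun i _ => sq_nonneg _] at h1
  ext i
  have := h1 i (Finset.mem_univ i)
  simpa [sub_eq_zero] using this

lemma Coercive.mulVec_inv (hc : 0 < c) (hR : Coercive c R) (y : ι → ℝ) :
    R *ᵥ (R⁻¹ *ᵥ y) = y := by
  rw [Matrix.mulVec_mulVec, Matrix.mul_nonsing_inv _ (hR.isUnit_det hc), Matrix.one_mulVec]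

lemma Coercive.inv_mulVec (hc : 0 < c) (hR : Coercive c R) (y : ι → ℝ) :
    R⁻¹ *ᵥ (R *ᵥ y) = y := by
  rw [Matrix.mulVec_mulVec, Matrix.nonsing_inv_mul _ (hR.isUnit_det hc), Matrix.one_mulVec]

lemma Coercive.opBound_inv (hc : 0 < c) (hR : Coercive c R) : OpBound c⁻¹ R⁻¹ := by
  intro y
  simpa [hR.mulVec_inv hc] using hR.le_l2_mulVec hc (R⁻¹ *ᵥ y)

/-- Put `y = R x`: the form is `⟨x, R x⟩ ≥ c |x|²`, and `|y| ≤ C |x|`. -/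
lemma Coercive.inv_form_ge (hc : 0 < c) (hC : 0 < C) (hR : Coercive c R) (hRC : OpBound C R)
    (y : ι → ℝ) : c / C ^ 2 * l2 y ^ 2 ≤ (R⁻¹ *ᵥ y) ⬝ᵥ y := by
  have h1 := hR (R⁻¹ *ᵥ y)
  rw [hR.mulVec_inv hc] at h1
  have h2 := hRC (R⁻¹ *ᵥ y)
  rw [hR.mulVec_inv hc] at h2
  have h3 : l2 y ^ 2 ≤ C ^ 2 * l2 (R⁻¹ *ᵥ y) ^ 2 := by
    rw [← mul_pow]; exact pow_le_pow_left₀ (l2_nonneg _) h2 2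
  refine le_trans ?_ h1
  rw [div_mul_eq_mul_div, div_le_iff₀ (by positivity)]
  nlinarith

end Inverse

/-- `y'`, indexed by `β`, is close to the restriction along `e` of `y`, and `y` is small where the
weight `w` is large. -/
structure Approx (e : β → ι) (w : ι → ℝ) (δ A : ℝ) (y' : β → ℝ) (y : ι → ℝ) : Prop where
  norm_le : l2 y ≤ A
  tail_le : l2 (w * y) ≤ A * δ
  diff_le : l2 (y' - y ∘ e) ≤ A * δ

section Restriction

variable {e : β → ι} {w : ι → ℝ} {δ A C c : ℝ} {y' : β → ℝ} {y : ι → ℝ}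

lemma l2_comp_le (he : Function.Injective e) (y : ι → ℝ) : l2 (y ∘ e) ≤ l2 y := by
  classical
  refine l2_le_of_sq_le (l2_nonneg y) ?_
  rw [l2_sq]
  simp only [Function.comp_apply]
  rw [← Finset.sum_image (s := Finset.univ) (g := e) (f := fun i => y i ^ 2)
    fun a _ b _ h => he h]
  exact Finset.sum_le_sum_of_subset_of_nonneg (Finset.subset_univ _) fun i _ _ => sq_nonneg _

lemma submatrix_mulVec_comp (he : Function.Injective e) (Q : Matrix ι ι ℝ) (y : ι → ℝ) :
    Q.submatrix e e *ᵥ (y ∘ e) = (Q *ᵥ Function.extend e (y ∘ e) 0) ∘ e := by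
  ext b
  simp only [Matrix.mulVec, dotProduct, Function.comp_apply, Matrix.submatrix_apply]
  refine Fintype.sum_of_injective e he _ _ (fun i hi => ?_) fun i => ?_
  · rw [Function.extend_apply' _ _ _ (by simpa using hi)]; simp
  · rw [he.extend_apply]; rfl

/-- The truncation error is `Q` applied to the part of `y` outside the range of `e`. There `w ≥ 1`,
so that part is dominated by `w * y`. -/
lemma l2_submatrix_mulVec_sub_le (he : Function.Injective e) (hw : ∀ i ∉ Set.range e, 1 ≤ w i)
    {Q : Matrix ι ι ℝ} (hC : 0 ≤ C) (hQ : OpBound C Q) (y : ι → ℝ) :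
    l2 (Q.submatrix e e *ᵥ (y ∘ e) - (Q *ᵥ y) ∘ e) ≤ C * l2 (w * y) := by
  have h1 : Q.submatrix e e *ᵥ (y ∘ e) - (Q *ᵥ y) ∘ e
      = (Q *ᵥ (Function.extend e (y ∘ e) 0 - y)) ∘ e := by
    rw [submatrix_mulVec_comp he, Matrix.mulVec_sub]; rfl
  rw [h1]
  refine ((l2_comp_le he _).trans (hQ _)).trans (mul_le_mul_of_nonneg_left (l2_mono fun i => ?_) hC)
  by_cases hi : i ∈ Set.range e
  · obtain ⟨b, rfl⟩ := hi
    rw [Pi.sub_apply, he.extend_apply]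
    simpa using mul_nonneg (abs_nonneg (w (e b))) (abs_nonneg (y (e b)))
  · rw [Pi.sub_apply, Function.extend_apply' _ _ _ (by simpa using hi)]
    simp only [Pi.zero_apply, zero_sub, abs_neg, Pi.mul_apply, abs_mul]
    exact le_mul_of_one_le_left (abs_nonneg _) ((hw i hi).trans (le_abs_self _))

lemma Approx.nonneg (h : Approx e w δ A y' y) : 0 ≤ A := (l2_nonneg y).trans h.norm_le

/-- The starting point of the propagation of `Approx`: both errors are zero because the weight
vanishes at the centre. -/
lemma approx_single [DecidableEq ι] [DecidableEq β] (he : Function.Injective e) (hδ : 0 ≤ δ)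
    {b : β} (hw : w (e b) = 0) :
    Approx e w δ 1 (Pi.single b 1) (Pi.single (e b) 1) where
  norm_le := (l2_single _).le
  tail_le := by
    have : w * Pi.single (e b) (1 : ℝ) = 0 := by
      ext i
      by_cases hi : i = e b
      · subst hi; simp [hw]
      · simp [hi]
    rw [this, l2_zero]; simpa using hδ
  diff_le := by
    have : (Pi.single b 1 : β → ℝ) - (Pi.single (e b) 1 : ι → ℝ) ∘ e = 0 := by
      ext i
      simp [Pi.single_apply, he.eq_iff]
    rw [this, l2_zero]; simpa using hδ

/-- The tail bound comes from `w Q y = [w, Q] y + Q (w y)`; the difference splits into the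
propagated error and the truncation error. -/
lemma Approx.mulVec (he : Function.Injective e) (hw : ∀ i ∉ Set.range e, 1 ≤ w i) (hδ : 0 ≤ δ)
    (hC : 0 ≤ C) {Q : Matrix ι ι ℝ} (hQ : OpBound C Q) (hQ' : OpBound C (Q.submatrix e e))
    (hQw : CommBound w δ Q) (h : Approx e w δ A y' y) :
    Approx e w δ ((2 * C + 1) * A) (Q.submatrix e e *ᵥ y') (Q *ᵥ y) where
  norm_le := by
    refine (hQ y).trans ?_
    nlinarith [h.nonneg, mul_le_mul_of_nonneg_left h.norm_le hC, mul_nonneg hC h.nonneg]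
  tail_le := by
    have h1 : w * (Q *ᵥ y) = (w * (Q *ᵥ y) - Q *ᵥ (w * y)) + Q *ᵥ (w * y) := by abel
    rw [h1]
    refine (l2_add_le _ _).trans ?_
    have h2 := hQw y
    have h3 := hQ (w * y)
    nlinarith [mul_le_mul_of_nonneg_left h.norm_le hδ, mul_le_mul_of_nonneg_left h.tail_le hC,
      mul_nonneg hC (mul_nonneg h.nonneg hδ)]
  diff_le := by
    have h1 : Q.submatrix e e *ᵥ y' - (Q *ᵥ y) ∘ e = Q.submatrix e e *ᵥ (y' - y ∘ e)
        + (Q.submatrix e e *ᵥ (y ∘ e) - (Q *ᵥ y) ∘ e) := by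
      rw [Matrix.mulVec_sub]; abel
    rw [h1]
    refine (l2_add_le _ _).trans ?_
    have h2 := hQ' (y' - y ∘ e)
    have h3 := l2_submatrix_mulVec_sub_le he hw hC hQ y
    nlinarith [mul_le_mul_of_nonneg_left h.diff_le hC, mul_le_mul_of_nonneg_left h.tail_le hC,
      mul_nonneg h.nonneg hδ]

/-- The constant by which `Approx.inv_mulVec` worsens the approximation. -/
noncomputable def invFactor (c C : ℝ) : ℝ := c⁻¹ + (1 + C * c⁻¹) * (c⁻¹ * (1 + c⁻¹))

/-- No decay of the entries of `R⁻¹` is needed: `R (w R⁻¹ y) = w y - [w, R] R⁻¹ y` is small, and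
coercivity transfers the smallness to `w R⁻¹ y`. -/
lemma Approx.inv_mulVec [DecidableEq ι] [DecidableEq β] (he : Function.Injective e)
    (hw : ∀ i ∉ Set.range e, 1 ≤ w i) (hδ : 0 ≤ δ)
    (hC : 0 ≤ C) (hc : 0 < c) {R : Matrix ι ι ℝ} (hR : OpBound C R) (hRc : Coercive c R)
    (hRc' : Coercive c (R.submatrix e e)) (hRw : CommBound w δ R) (h : Approx e w δ A y' y) :
    Approx e w δ (invFactor c C * A) ((R.submatrix e e)⁻¹ *ᵥ y') (R⁻¹ *ᵥ y) := by
  have hA := h.nonneg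
  have hq : 0 < c⁻¹ := inv_pos.2 hc
  have hn : l2 (R⁻¹ *ᵥ y) ≤ c⁻¹ * A :=
    (hRc.opBound_inv hc y).trans (mul_le_mul_of_nonneg_left h.norm_le hq.le)
  have ht : l2 (w * (R⁻¹ *ᵥ y)) ≤ c⁻¹ * (1 + c⁻¹) * (A * δ) := by
    refine (hRc.le_l2_mulVec hc _).trans ?_
    have h1 : R *ᵥ (w * (R⁻¹ *ᵥ y))
        = w * y - (w * (R *ᵥ (R⁻¹ *ᵥ y)) - R *ᵥ (w * (R⁻¹ *ᵥ y))) := by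
      rw [hRc.mulVec_inv hc]; abel
    have h2 : l2 (R *ᵥ (w * (R⁻¹ *ᵥ y))) ≤ (1 + c⁻¹) * (A * δ) := by
      rw [h1]
      refine (l2_sub_le _ _).trans ?_
      have h3 := (hRw (R⁻¹ *ᵥ y)).trans (mul_le_mul_of_nonneg_left hn hδ)
      nlinarith [h.tail_le]
    rw [mul_assoc]
    exact mul_le_mul_of_nonneg_left h2 hq.le
  have hAδ : 0 ≤ A * δ := mul_nonneg hA hδ
  refine ⟨hn.trans ?_, ht.trans ?_, ?_⟩
  · refine mul_le_mul_of_nonneg_right ?_ hA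
    rw [invFactor]
    have : 0 ≤ (1 + C * c⁻¹) * (c⁻¹ * (1 + c⁻¹)) := by positivity
    linarith
  · rw [mul_assoc (invFactor c C)]
    refine mul_le_mul_of_nonneg_right ?_ hAδ
    rw [invFactor]
    have : 0 ≤ (C * c⁻¹) * (c⁻¹ * (1 + c⁻¹)) := by positivity
    nlinarith
  · refine (hRc'.le_l2_mulVec hc _).trans ?_
    -- Applying the truncated matrix to the error leaves the initial error and a truncation error
    -- governed by the tail just bounded.
    have h1 : R.submatrix e e *ᵥ ((R.submatrix e e)⁻¹ *ᵥ y' - (R⁻¹ *ᵥ y) ∘ e)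
        = (y' - y ∘ e) - (R.submatrix e e *ᵥ ((R⁻¹ *ᵥ y) ∘ e) - (R *ᵥ (R⁻¹ *ᵥ y)) ∘ e) := by
      rw [Matrix.mulVec_sub, hRc'.mulVec_inv hc, hRc.mulVec_inv hc]; abel
    have h2 : l2 (R.submatrix e e *ᵥ ((R.submatrix e e)⁻¹ *ᵥ y' - (R⁻¹ *ᵥ y) ∘ e))
        ≤ A * δ + C * (c⁻¹ * (1 + c⁻¹) * (A * δ)) := by
      rw [h1]
      refine (l2_sub_le _ _).trans (add_le_add h.diff_le ?_)
      exact (l2_submatrix_mulVec_sub_le he hw hC hR _).trans (mul_le_mul_of_nonneg_left ht hC)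
    refine (mul_le_mul_of_nonneg_left h2 hq.le).trans ?_
    rw [mul_assoc (invFactor c C), invFactor]
    have : 0 ≤ (c⁻¹ * (1 + c⁻¹)) * (A * δ) := by positivity
    nlinarith

lemma Approx.abs_sub_le (h : Approx e w δ A y' y) (b : β) : |y' b - y (e b)| ≤ A * δ :=
  (abs_apply_le_l2 (y' - y ∘ e) b).trans h.diff_le

end Restriction

end FiniteMatrices

/-! ### The diagonal entries of the Hessian matrix: formula, locality and lower bound. -/

section HessTerm

lemma OpBound.l2_mulVec_le {ι : Type*} [Fintype ι] {C D : ℝ} {Q : Matrix ι ι ℝ} (hC : 0 ≤ C) (hQ : OpBound C Q)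
    {y : ι → ℝ} (hy : l2 y ≤ D) : l2 (Q *ᵥ y) ≤ C * D :=
  (hQ y).trans (mul_le_mul_of_nonneg_left hy hC)

variable {ι β : Type*} [Fintype ι] [Fintype β] [DecidableEq ι] [DecidableEq β]

/-- A diagonal entry of the matrix `M_{CV,2}` in terms of `a = (R⁻¹)_{ll}`,
`b = (R⁻¹ G R⁻¹)_{ll}`, `b' = (R⁻¹ H R⁻¹)_{ll}` and `c = (R⁻¹ G R⁻¹ H R⁻¹)_{ll}`. -/
noncomputable def hessFun (a b b' c : ℝ) : ℝ := 2 * c / a ^ 2 - 2 * b * b' / a ^ 3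

/-- The diagonal entry with index `l` of the matrix `M_{CV,2}`. -/
noncomputable def hessTerm (R G H : Matrix ι ι ℝ) (l : ι) : ℝ :=
  hessFun (R⁻¹ l l) ((R⁻¹ * G * R⁻¹) l l) ((R⁻¹ * H * R⁻¹) l l) ((R⁻¹ * G * R⁻¹ * H * R⁻¹) l l)

lemma mulVec_single_apply (R : Matrix ι ι ℝ) (l i : ι) : (R *ᵥ Pi.single l 1) i = R i l := by
  simp

lemma inv_apply_eq (R : Matrix ι ι ℝ) (l : ι) : R⁻¹ l l = (R⁻¹ *ᵥ Pi.single l 1) l := by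
  simp

lemma inv_mul_inv_apply_eq (R G : Matrix ι ι ℝ) (l : ι) :
    (R⁻¹ * G * R⁻¹) l l = (R⁻¹ *ᵥ (G *ᵥ (R⁻¹ *ᵥ Pi.single l 1))) l := by
  rw [Matrix.mulVec_mulVec, Matrix.mulVec_mulVec, mulVec_single_apply, Matrix.mul_assoc]

lemma inv_mul_inv_mul_inv_apply_eq (R G H : Matrix ι ι ℝ) (l : ι) :
    (R⁻¹ * G * R⁻¹ * H * R⁻¹) l l
      = (R⁻¹ *ᵥ (G *ᵥ (R⁻¹ *ᵥ (H *ᵥ (R⁻¹ *ᵥ Pi.single l 1))))) l := by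
  simp only [Matrix.mulVec_mulVec, mulVec_single_apply, Matrix.mul_assoc]

lemma inv_diagPart {n : ℕ} {A : Matrix (Fin n) (Fin n) ℝ} (h : ∀ l, A l l ≠ 0) :
    (diagPart A)⁻¹ = Matrix.diagonal fun l => (A l l)⁻¹ := by
  rw [diagPart]
  refine Matrix.inv_eq_right_inv ?_
  rw [Matrix.diagonal_mul_diagonal, ← Matrix.diagonal_one]
  congr 1
  ext l
  exact mul_inv_cancel₀ (h l)

/-- On the diagonal the last factor `R⁻¹` cancels one power of `a⁻⁴`, so the coefficients `-8` and
`6` merge into `-2`. -/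
lemma trace_cvHessianOf {n : ℕ} {R G H : Matrix (Fin n) (Fin n) ℝ} (h : ∀ l, R⁻¹ l l ≠ 0) :
    (cvHessianOf R G H).trace = ∑ l, hessTerm R G H l := by
  rw [Matrix.trace]
  refine Finset.sum_congr rfl fun l _ => ?_
  have hl := h l
  simp only [cvHessianOf, inv_diagPart h]
  simp only [diagPart, Matrix.diagonal_pow,
    Matrix.diagonal_mul_diagonal, Matrix.diag_apply, Matrix.add_apply, Matrix.smul_apply,
    Matrix.diagonal_mul, smul_eq_mul, hessTerm, hessFun, Pi.pow_apply]
  field_simp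
  ring

lemma Coercive.inv_apply_ge {R : Matrix ι ι ℝ} {c C : ℝ} (hc : 0 < c) (hC : 0 < C)
    (hR : Coercive c R) (hRC : OpBound C R) (l : ι) : c / C ^ 2 ≤ R⁻¹ l l := by
  have h := hR.inv_form_ge hc hC hRC (Pi.single l 1)
  simpa [l2_single, dotProduct_single] using h

lemma Coercive.inv_apply_le {R : Matrix ι ι ℝ} {c : ℝ} (hc : 0 < c)
    (hR : Coercive c R) (l : ι) : R⁻¹ l l ≤ c⁻¹ := by
  have h := (abs_apply_le_l2 _ l).trans (hR.opBound_inv hc (Pi.single l 1))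
  rw [mulVec_single_apply, l2_single, mul_one] at h
  exact (le_abs_self _).trans h

/-- The bound `a ≥ a₀` confines the arguments to a compact set avoiding the pole `a = 0`, where
continuity is uniform. -/
lemma hessFun_uniformContinuousOn {a₀ B η : ℝ} (ha : 0 < a₀) (hη : 0 < η) :
    ∃ ρ > 0, ∀ a b b' c x y y' z : ℝ, a₀ ≤ a → |a| ≤ B → |b| ≤ B → |b'| ≤ B → |c| ≤ B →
      a₀ ≤ x → |x| ≤ B → |y| ≤ B → |y'| ≤ B → |z| ≤ B →
      |x - a| < ρ → |y - b| < ρ → |y' - b'| < ρ → |z - c| < ρ →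
      |hessFun x y y' z - hessFun a b b' c| ≤ η := by
  let s : Set (ℝ × ℝ × ℝ × ℝ) :=
    Set.Icc a₀ B ×ˢ Set.Icc (-B) B ×ˢ Set.Icc (-B) B ×ˢ Set.Icc (-B) B
  have hs : IsCompact s :=
    isCompact_Icc.prod (isCompact_Icc.prod (isCompact_Icc.prod isCompact_Icc))
  have hcont : ContinuousOn (fun q : ℝ × ℝ × ℝ × ℝ => hessFun q.1 q.2.1 q.2.2.1 q.2.2.2) s := by
    have h0 : ∀ q ∈ s, q.1 ≠ 0 := fun q hq => (ha.trans_le hq.1.1).ne'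
    unfold hessFun
    refine ContinuousOn.sub (ContinuousOn.div (by fun_prop) (by fun_prop) ?_)
      (ContinuousOn.div (by fun_prop) (by fun_prop) ?_)
    · exact fun q hq => pow_ne_zero _ (h0 q hq)
    · exact fun q hq => pow_ne_zero _ (h0 q hq)
  obtain ⟨ρ, hρ, h⟩ :=
    Metric.uniformContinuousOn_iff.1 (hs.uniformContinuousOn_of_continuous hcont) η hη
  refine ⟨ρ, hρ, fun a b b' c x y y' z h1 h2 h3 h4 h5 h6 h7 h8 h9 h10 h11 h12 h13 h14 => ?_⟩
  have := h (x, y, y', z)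
    ⟨⟨h6, (abs_le.1 h7).2⟩, abs_le.1 h8, abs_le.1 h9, abs_le.1 h10⟩ (a, b, b', c)
    ⟨⟨h1, (abs_le.1 h2).2⟩, abs_le.1 h3, abs_le.1 h4, abs_le.1 h5⟩
    (by simp only [Prod.dist_eq, Real.dist_eq, max_lt_iff]; exact ⟨h11, h12, h13, h14⟩)
  exact this.le

/-- A bound for the quantities which enter a diagonal entry of `M_{CV,2}`. -/
noncomputable def hessBound (c C : ℝ) : ℝ :=
  c⁻¹ + c⁻¹ * (C * c⁻¹) + c⁻¹ * (C * (c⁻¹ * (C * c⁻¹)))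

lemma hess_entries_le {R G H : Matrix ι ι ℝ} {c C : ℝ} (hc : 0 < c) (hC : 0 < C)
    (hR : Coercive c R) (hG : OpBound C G) (hH : OpBound C H) (l : ι) :
    |R⁻¹ l l| ≤ hessBound c C ∧ |(R⁻¹ * G * R⁻¹) l l| ≤ hessBound c C ∧
      |(R⁻¹ * G * R⁻¹ * H * R⁻¹) l l| ≤ hessBound c C := by
  have hi : 0 < c⁻¹ := inv_pos.2 hc
  have h0 : l2 (R⁻¹ *ᵥ Pi.single l 1) ≤ c⁻¹ := by
    simpa [l2_single] using hR.opBound_inv hc (Pi.single l 1)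
  have h1 : ∀ Q : Matrix ι ι ℝ, OpBound C Q → ∀ D (y : ι → ℝ), l2 y ≤ D →
      l2 (R⁻¹ *ᵥ (Q *ᵥ y)) ≤ c⁻¹ * (C * D) := fun Q hQ D y hy =>
    (hR.opBound_inv hc).l2_mulVec_le hi.le (hQ.l2_mulVec_le hC.le hy)
  have h2 : 0 ≤ c⁻¹ * (C * c⁻¹) := by positivity
  have h3 : 0 ≤ c⁻¹ * (C * (c⁻¹ * (C * c⁻¹))) := by positivity
  rw [inv_mul_inv_apply_eq, inv_mul_inv_mul_inv_apply_eq, inv_apply_eq, hessBound]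
  refine ⟨((abs_apply_le_l2 _ l).trans h0).trans (by linarith),
    ((abs_apply_le_l2 _ l).trans (h1 G hG _ _ h0)).trans (by linarith),
    ((abs_apply_le_l2 _ l).trans (h1 G hG _ _ (h1 H hH _ _ h0))).trans (by linarith)⟩

/-- The bound does not depend on the size of the matrices; it controls the boundary indices and
makes the law of large numbers applicable. -/
lemma hessTerm_bounded {c C : ℝ} (hc : 0 < c) (hC : 0 < C) :
    ∃ B > 0, ∀ {ι : Type} [Fintype ι] [DecidableEq ι] {R G H : Matrix ι ι ℝ}, OpBound C R →
      OpBound C G → OpBound C H → Coercive c R → ∀ l, |hessTerm R G H l| ≤ B := by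
  set D := hessBound c C with hD
  have hDp : 0 < D := by rw [hD, hessBound]; positivity
  have ha0 : 0 < c / C ^ 2 := by positivity
  refine ⟨2 * D / (c / C ^ 2) ^ 2 + 2 * D * D / (c / C ^ 2) ^ 3, by positivity, ?_⟩
  intro ι _ _ R G H hR hG hH hRc l
  obtain ⟨h1, h2, h3⟩ := hess_entries_le hc hC hRc hG hH l
  obtain ⟨-, h4, -⟩ := hess_entries_le hc hC hRc hH hG l
  have ha := hRc.inv_apply_ge hc hC hR l
  have hap : 0 < R⁻¹ l l := ha0.trans_le ha
  rw [hessTerm, hessFun]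
  refine (abs_sub _ _).trans (add_le_add ?_ ?_)
  · rw [abs_div, abs_mul, abs_of_pos (by positivity : 0 < (R⁻¹ l l) ^ 2), abs_two]
    gcongr
  · rw [abs_div, abs_mul, abs_mul, abs_of_pos (by positivity : 0 < (R⁻¹ l l) ^ 3), abs_two]
    gcongr

/-- The diagonal entry of `M_{CV,2}` depends, up to `η`, only on a neighbourhood of the index. -/
theorem hessTerm_local {c C η : ℝ} (hc : 0 < c) (hC : 0 < C) (hη : 0 < η) :
    ∃ δ₀ > 0, ∀ {ι β : Type} [Fintype ι] [Fintype β] [DecidableEq ι] [DecidableEq β]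
      (e : β → ι) (w : ι → ℝ) (R G H : Matrix ι ι ℝ) (δ : ℝ) (b : β),
      Function.Injective e → (∀ i ∉ Set.range e, 1 ≤ w i) → w (e b) = 0 → 0 ≤ δ → δ ≤ δ₀ →
      OpBound C R → OpBound C G → OpBound C H → Coercive c R →
      OpBound C (R.submatrix e e) → OpBound C (G.submatrix e e) → OpBound C (H.submatrix e e) →
      Coercive c (R.submatrix e e) →
      CommBound w δ R → CommBound w δ G → CommBound w δ H →
      |hessTerm (R.submatrix e e) (G.submatrix e e) (H.submatrix e e) b
        - hessTerm R G H (e b)| ≤ η := by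
  have ha0 : 0 < c / C ^ 2 := by positivity
  obtain ⟨ρ, hρ, hcont⟩ := hessFun_uniformContinuousOn (B := hessBound c C) ha0 hη
  set q := invFactor c C with hq
  set m := 2 * C + 1 with hm
  have hqp : 0 < q := by rw [hq, invFactor]; positivity
  have hmp : 0 < m := by positivity
  -- The three summands are the constants reached by the chains `R⁻¹ e`, `R⁻¹GR⁻¹ e` and
  -- `R⁻¹GR⁻¹HR⁻¹ e`; their sum serves all of them.
  set A := q * 1 + q * (m * (q * 1)) + q * (m * (q * (m * (q * 1)))) with hA
  have hAp : 0 < A := by positivity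
  refine ⟨ρ / (2 * A), by positivity, ?_⟩
  intro ι β _ _ _ _ e w R G H δ b he hw hw0 hδ hδ' hR hG hH hRc hR' hG' hH' hRc' hRw hGw hHw
  have hAδ : A * δ < ρ := by
    rw [le_div_iff₀ (by positivity)] at hδ'
    nlinarith
  have hI := fun {A' : ℝ} {y' : β → ℝ} {y : ι → ℝ} (h : Approx e w δ A' y' y) =>
    h.inv_mulVec he hw hδ hC.le hc hR hRc hRc' hRw
  have hu := hI (approx_single he hδ hw0)
  have hGu := hI (hu.mulVec he hw hδ hC.le hG hG' hGw)
  have hHu := hI (hu.mulVec he hw hδ hC.le hH hH' hHw)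
  have hGHu := hI (hHu.mulVec he hw hδ hC.le hG hG' hGw)
  have l1 : q * 1 ≤ A := by
    have : 0 ≤ q * (m * (q * 1)) + q * (m * (q * (m * (q * 1)))) := by positivity
    linarith
  have l2' : q * (m * (q * 1)) ≤ A := by
    have : 0 ≤ q * 1 + q * (m * (q * (m * (q * 1)))) := by positivity
    linarith
  have l3 : q * (m * (q * (m * (q * 1)))) ≤ A := by
    have : 0 ≤ q * 1 + q * (m * (q * 1)) := by positivity
    linarith
  obtain ⟨a1, a2, a3⟩ := hess_entries_le hc hC hRc hG hH (e b)
  obtain ⟨-, a4, -⟩ := hess_entries_le hc hC hRc hH hG (e b)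
  obtain ⟨b1, b2, b3⟩ := hess_entries_le hc hC hRc' hG' hH' b
  obtain ⟨-, b4, -⟩ := hess_entries_le hc hC hRc' hH' hG' b
  refine hcont _ _ _ _ _ _ _ _ (hRc.inv_apply_ge hc hC hR (e b)) a1 a2 a4 a3
    (hRc'.inv_apply_ge hc hC hR' b) b1 b2 b4 b3 ?_ ?_ ?_ ?_
  · rw [inv_apply_eq, inv_apply_eq]
    exact (hu.abs_sub_le b).trans_lt ((mul_le_mul_of_nonneg_right l1 hδ).trans_lt hAδ)
  · rw [inv_mul_inv_apply_eq, inv_mul_inv_apply_eq]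
    exact (hGu.abs_sub_le b).trans_lt ((mul_le_mul_of_nonneg_right l2' hδ).trans_lt hAδ)
  · rw [inv_mul_inv_apply_eq, inv_mul_inv_apply_eq]
    exact (hHu.abs_sub_le b).trans_lt ((mul_le_mul_of_nonneg_right l2' hδ).trans_lt hAδ)
  · rw [inv_mul_inv_mul_inv_apply_eq, inv_mul_inv_mul_inv_apply_eq]
    exact (hGHu.abs_sub_le b).trans_lt ((mul_le_mul_of_nonneg_right l3 hδ).trans_lt hAδ)

lemma hessTerm_comm {R G H : Matrix ι ι ℝ} (hR : Rᵀ = R) (hG : Gᵀ = G) (hH : Hᵀ = H) (l : ι) :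
    hessTerm R G H l = hessTerm R H G l := by
  have hA : R⁻¹ᵀ = R⁻¹ := by rw [Matrix.transpose_nonsing_inv, hR]
  have h : (R⁻¹ * G * R⁻¹ * H * R⁻¹)ᵀ = R⁻¹ * H * R⁻¹ * G * R⁻¹ := by
    simp only [Matrix.transpose_mul, hA, hG, hH, Matrix.mul_assoc]
  have h' := congrFun (congrFun h l) l
  rw [Matrix.transpose_apply] at h'
  rw [hessTerm, hessTerm, h', hessFun, hessFun]
  ring

/-- Bilinearity in the two derivatives turns the quadratic form of the limit matrix into a single
term with `G = H`. -/
lemma hessTerm_sum {κ : Type*} [Fintype κ] (R : Matrix ι ι ℝ) (G : κ → Matrix ι ι ℝ)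
    (lam : κ → ℝ) (l : ι) :
    hessTerm R (∑ i, lam i • G i) (∑ i, lam i • G i) l
      = ∑ i, ∑ j, lam i * lam j * hessTerm R (G i) (G j) l := by
  have h1 : (R⁻¹ * (∑ i, lam i • G i) * R⁻¹) l l = ∑ i, lam i * (R⁻¹ * G i * R⁻¹) l l := by
    simp [Matrix.mul_sum, Matrix.sum_mul, Matrix.sum_apply]
  have h2 : (R⁻¹ * (∑ i, lam i • G i) * R⁻¹ * (∑ i, lam i • G i) * R⁻¹) l l
      = ∑ i, ∑ j, lam i * lam j * (R⁻¹ * G i * R⁻¹ * G j * R⁻¹) l l := by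
    rw [Finset.sum_comm]
    simp only [Matrix.sum_mul, Matrix.sum_apply, Matrix.mul_smul, Matrix.smul_mul,
      Matrix.smul_apply, smul_eq_mul, Finset.mul_sum]
    exact Finset.sum_congr rfl fun i _ => Finset.sum_congr rfl fun j _ => by ring
  simp only [hessTerm, hessFun]
  rw [h1, h2, mul_assoc 2, Finset.sum_mul_sum, Finset.mul_sum, Finset.sum_div, Finset.mul_sum,
    Finset.sum_div, ← Finset.sum_sub_distrib]
  refine Finset.sum_congr rfl fun i _ => ?_
  rw [Finset.mul_sum, Finset.sum_div, Finset.mul_sum, Finset.sum_div, ← Finset.sum_sub_distrib]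
  refine Finset.sum_congr rfl fun j _ => ?_
  ring

/-- The diagonal entries are Schur complements. -/
lemma hessTerm_self_ge {R G : Matrix ι ι ℝ} {c C : ℝ} (hc : 0 < c) (hC : 0 < C)
    (hRs : Rᵀ = R) (hGs : Gᵀ = G) (hR : OpBound C R) (hRc : Coercive c R) (l : ι) :
    2 * c ^ 2 * (c / C ^ 2) * l2 (fun m => (G * R⁻¹) m l
      - ((R⁻¹ * G * R⁻¹) l l / R⁻¹ l l) * (1 : Matrix ι ι ℝ) m l) ^ 2 ≤ hessTerm R G G l := by
  set a := R⁻¹ l l with ha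
  set b := (R⁻¹ * G * R⁻¹) l l with hb
  set y := (G * R⁻¹) *ᵥ Pi.single l 1 with hy
  have hAs : R⁻¹ᵀ = R⁻¹ := by rw [Matrix.transpose_nonsing_inv, hRs]
  have hap : 0 < a := (by positivity : 0 < c / C ^ 2).trans_le (hRc.inv_apply_ge hc hC hR l)
  have hac : a ≤ c⁻¹ := hRc.inv_apply_le hc l
  -- `z` is the component of `G R⁻¹ e_l` orthogonal to `e_l` for the form of `R⁻¹`; its energy is
  -- the Schur complement `c - b²/a`.
  set z := y - (b / a) • (Pi.single l 1 : ι → ℝ) with hz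
  have hzeq : (fun m => (G * R⁻¹) m l - (b / a) * (1 : Matrix ι ι ℝ) m l) = z := by
    ext m
    simp [hz, hy, Matrix.one_apply, Pi.single_apply]
  rw [hzeq]
  have h1 : (R⁻¹ *ᵥ y) ⬝ᵥ (Pi.single l 1 : ι → ℝ) = b := by
    rw [hy, dotProduct_single, mul_one, Matrix.mulVec_mulVec, mulVec_single_apply, ← mul_assoc]
  have h2 : (R⁻¹ *ᵥ (Pi.single l 1 : ι → ℝ)) ⬝ᵥ y = b := by
    rw [← h1, dotProduct_comm, Matrix.dotProduct_mulVec, ← Matrix.mulVec_transpose, hAs]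
  have h3 : (R⁻¹ *ᵥ (Pi.single l 1 : ι → ℝ)) ⬝ᵥ (Pi.single l 1 : ι → ℝ) = a := by simp [ha]
  have h4 : (R⁻¹ *ᵥ y) ⬝ᵥ y = (R⁻¹ * G * R⁻¹ * G * R⁻¹) l l := by
    have hyt : y = Pi.single l 1 ᵥ* (R⁻¹ * G) := by
      rw [hy, ← Matrix.mulVec_transpose, Matrix.transpose_mul, hAs, hGs]
    conv_lhs => rw [dotProduct_comm]; arg 1; rw [hyt]
    rw [← Matrix.dotProduct_mulVec, hy, single_one_dotProduct, Matrix.mulVec_mulVec,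
      Matrix.mulVec_mulVec, mulVec_single_apply]
    simp only [Matrix.mul_assoc]
  have hform : (R⁻¹ *ᵥ z) ⬝ᵥ z = (R⁻¹ * G * R⁻¹ * G * R⁻¹) l l - b * b / a := by
    rw [hz, Matrix.mulVec_sub, Matrix.mulVec_smul]
    simp only [sub_dotProduct, dotProduct_sub, smul_dotProduct, dotProduct_smul, h1, h2, h3, h4,
      smul_eq_mul]
    field_simp
    ring
  have hge := hRc.inv_form_ge hc hC hR z
  rw [hform] at hge
  have hT : hessTerm R G G l
      = 2 / a ^ 2 * ((R⁻¹ * G * R⁻¹ * G * R⁻¹) l l - b * b / a) := by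
    change 2 * _ / a ^ 2 - 2 * b * b / a ^ 3 = _
    field_simp
  rw [hT, mul_assoc]
  have hca : 2 * c ^ 2 ≤ 2 / a ^ 2 := by
    rw [le_div_iff₀ (by positivity)]
    have : c * a ≤ 1 := by
      have := mul_le_mul_of_nonneg_left hac hc.le
      rwa [mul_inv_cancel₀ hc.ne'] at this
    nlinarith [mul_pos hc hap]
  exact mul_le_mul hca hge (by positivity) (by positivity)

/-- The sum of the diagonal entries controls the Frobenius norm of `G`. -/
theorem sum_hessTerm_ge {R G : Matrix ι ι ℝ} {c C : ℝ} (hc : 0 < c) (hC : 0 < C)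
    (hRs : Rᵀ = R) (hGs : Gᵀ = G) (hR : OpBound C R) (hRc : Coercive c R)
    (hR1 : ∀ i, R i i = 1) (hG0 : ∀ i, G i i = 0) :
    2 * c ^ 2 * (c / C ^ 2) / ((2 + 2 * C ^ 2) * C ^ 2) * ∑ i, ∑ j, G i j ^ 2
      ≤ ∑ l, hessTerm R G G l := by
  set τ : ι → ℝ := fun l => (R⁻¹ * G * R⁻¹) l l / R⁻¹ l l with hτ
  -- The columns of `Q` are the vectors bounded by `hessTerm_self_ge`; multiplication by `R` gives
  -- `W`, from which `G` is to be recovered.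
  set Q : Matrix ι ι ℝ := G * R⁻¹ - Matrix.diagonal τ with hQ
  set W : Matrix ι ι ℝ := G - Matrix.diagonal τ * R with hW
  have hQR : Q * R = W := by
    rw [hQ, hW, Matrix.sub_mul, Matrix.mul_assoc,
      Matrix.nonsing_inv_mul _ (hRc.isUnit_det hc), Matrix.mul_one]
  have hcol : ∑ l, l2 (fun m => (G * R⁻¹) m l - τ l * (1 : Matrix ι ι ℝ) m l) ^ 2
      = ∑ i, ∑ j, Q i j ^ 2 := by
    rw [Finset.sum_comm]
    refine Finset.sum_congr rfl fun l _ => ?_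
    rw [l2_sq]
    refine Finset.sum_congr rfl fun m _ => ?_
    rw [hQ, Matrix.sub_apply, Matrix.diagonal_apply, Matrix.one_apply]
    split_ifs with h
    · subst h; simp
    · simp
  -- By symmetry of `R`, row `i` of `W = Q R` is `R` applied to row `i` of `Q`.
  have hrow : ∀ i, ∑ j, W i j ^ 2 ≤ C ^ 2 * ∑ j, Q i j ^ 2 := by
    intro i
    have h1 : W i = R *ᵥ Q i := by
      ext j
      rw [← hQR, Matrix.mul_apply, Matrix.mulVec, dotProduct]
      refine Finset.sum_congr rfl fun k _ => ?_
      rw [mul_comm, ← congrFun (congrFun hRs j) k, Matrix.transpose_apply]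
    have h2 := pow_le_pow_left₀ (l2_nonneg _) (hR (Q i)) 2
    rw [mul_pow, l2_sq, l2_sq] at h2
    simpa [h1] using h2
  have hRrow : ∀ i, ∑ j, R i j ^ 2 ≤ C ^ 2 := by
    intro i
    have h2 := pow_le_pow_left₀ (l2_nonneg _) (hR (Pi.single i 1)) 2
    rw [mul_pow, l2_sq, l2_single, one_pow, mul_one] at h2
    refine le_of_eq_of_le (Finset.sum_congr rfl fun j _ => ?_) h2
    rw [mulVec_single_apply, ← congrFun (congrFun hRs i) j, Matrix.transpose_apply]
  -- The normalisation enters here: with `R i i = 1` and `G i i = 0`, the unknown `τ i` is, up to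
  -- sign, a diagonal entry of `W`. Then `G = W + τ R` is controlled by `W`.
  have hdiag : ∀ i, τ i ^ 2 ≤ ∑ j, W i j ^ 2 := by
    intro i
    have h1 : W i i = -τ i := by
      rw [hW, Matrix.sub_apply, Matrix.diagonal_mul, hR1, hG0]; ring
    have h2 := Finset.single_le_sum (f := fun j => W i j ^ 2) (fun j _ => sq_nonneg (W i j))
      (Finset.mem_univ i)
    simpa [h1] using h2
  have hG : ∀ i, ∑ j, G i j ^ 2 ≤ (2 + 2 * C ^ 2) * C ^ 2 * ∑ j, Q i j ^ 2 := by
    intro i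
    have h1 : ∑ j, G i j ^ 2 ≤ ∑ j, (2 * W i j ^ 2 + 2 * τ i ^ 2 * R i j ^ 2) := by
      refine Finset.sum_le_sum fun j _ => ?_
      have h2 : G i j = W i j + τ i * R i j := by
        rw [hW, Matrix.sub_apply, Matrix.diagonal_mul]; ring
      rw [h2]
      nlinarith [sq_nonneg (W i j - τ i * R i j)]
    rw [Finset.sum_add_distrib, ← Finset.mul_sum, ← Finset.mul_sum] at h1
    have h3 : 2 * τ i ^ 2 * ∑ j, R i j ^ 2 ≤ 2 * (∑ j, W i j ^ 2) * C ^ 2 :=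
      mul_le_mul (mul_le_mul_of_nonneg_left (hdiag i) (by norm_num)) (hRrow i)
        (Finset.sum_nonneg fun _ _ => sq_nonneg _)
        (mul_nonneg (by norm_num) (Finset.sum_nonneg fun _ _ => sq_nonneg _))
    have h4 : (2 + 2 * C ^ 2) * ∑ j, W i j ^ 2
        ≤ (2 + 2 * C ^ 2) * (C ^ 2 * ∑ j, Q i j ^ 2) :=
      mul_le_mul_of_nonneg_left (hrow i) (by positivity)
    linarith
  have hsum : ∑ i, ∑ j, G i j ^ 2 ≤ (2 + 2 * C ^ 2) * C ^ 2 * ∑ i, ∑ j, Q i j ^ 2 := by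
    rw [Finset.mul_sum]
    exact Finset.sum_le_sum fun i _ => hG i
  have hfin : 2 * c ^ 2 * (c / C ^ 2) * ∑ i, ∑ j, Q i j ^ 2 ≤ ∑ l, hessTerm R G G l := by
    rw [← hcol, Finset.mul_sum]
    exact Finset.sum_le_sum fun l _ => hessTerm_self_ge hc hC hRs hGs hR hRc l
  refine le_trans ?_ hfin
  rw [div_mul_eq_mul_div, div_le_iff₀ (by positivity), mul_assoc _ (∑ i, ∑ j, Q i j ^ 2)]
  refine mul_le_mul_of_nonneg_left ?_ (by positivity)
  linarith

end HessTerm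

/-! ### A strong law of large numbers under finite-range dependence. -/

section LawOfLargeNumbers

lemma tendsto_nat_sqrt_atTop : Tendsto Nat.sqrt atTop atTop := by
  refine tendsto_atTop.2 fun b => ?_
  filter_upwards [eventually_ge_atTop (b ^ 2)] with n hn
  exact Nat.le_sqrt'.2 hn

/-- Convergence along squares suffices: `n` exceeds the largest square below it by at most `2√n`, so
bounded increments contribute `O(√n)`. -/
lemma tendsto_div_of_tendsto_sq {a : ℕ → ℝ} {B : ℝ}
    (hB : ∀ m n, m ≤ n → |a n - a m| ≤ B * (n - m))
    (h : Tendsto (fun m : ℕ => |a (m ^ 2)| / (m : ℝ) ^ 2) atTop (𝓝 0)) :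
    Tendsto (fun n : ℕ => 1 / (n : ℝ) * a n) atTop (𝓝 0) := by
  have hB0 : 0 ≤ B := by
    have := (abs_nonneg _).trans (hB 0 1 zero_le_one)
    simpa using this
  have h1 : Tendsto (fun m : ℕ => |a (m ^ 2)| / (m : ℝ) ^ 2 + 2 * B / (m : ℝ)) atTop (𝓝 0) := by
    simpa using h.add (tendsto_const_div_atTop_nhds_zero_nat (2 * B))
  refine squeeze_zero_norm' ?_ (h1.comp tendsto_nat_sqrt_atTop)
  filter_upwards [eventually_ge_atTop 1] with n hn
  set m := n.sqrt with hm
  have hm1 : 1 ≤ m := Nat.le_sqrt'.2 (by simpa using hn)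
  have hmn : m ^ 2 ≤ n := Nat.sqrt_le' n
  have hnm : n ≤ m ^ 2 + 2 * m := by
    have := Nat.sqrt_le_add n
    rw [← hm] at this
    nlinarith
  have hm0 : (0 : ℝ) < m := by exact_mod_cast hm1
  have hmn' : (m : ℝ) ^ 2 ≤ n := by exact_mod_cast hmn
  have hnm' : (n : ℝ) ≤ (m : ℝ) ^ 2 + 2 * m := by exact_mod_cast hnm
  have hn0 : (0 : ℝ) < n := by exact_mod_cast hn
  have h2 : |a n| ≤ |a (m ^ 2)| + 2 * B * m := by
    have h3 := hB _ _ hmn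
    have h4 := abs_sub_abs_le_abs_sub (a n) (a (m ^ 2))
    push_cast at h3
    nlinarith
  simp only [Function.comp_apply, Real.norm_eq_abs, abs_mul, ← hm]
  rw [abs_of_pos (by positivity : 0 < 1 / (n : ℝ)), one_div_mul_eq_div, div_le_iff₀ hn0]
  calc |a n| ≤ |a (m ^ 2)| + 2 * B * m := h2
    _ = (|a (m ^ 2)| / (m : ℝ) ^ 2 + 2 * B / m) * (m : ℝ) ^ 2 := by field_simp
    _ ≤ _ := by gcongr

variable {Ω : Type*} [MeasurableSpace Ω] {P : Measure Ω} [IsProbabilityMeasure P]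

lemma integrable_of_abs_le {f : Ω → ℝ} {B : ℝ} (hf : Measurable f) (hB : ∀ ω, |f ω| ≤ B) :
    Integrable f P :=
  Integrable.of_bound hf.aestronglyMeasurable B (ae_of_all _ hB)

/-- A strong law of large numbers for bounded variables, each of which is correlated with a bounded
number of the others. -/
theorem ae_tendsto_average_zero {Y : ℕ → Ω → ℝ} (hm : ∀ i, Measurable (Y i)) {B : ℝ}
    (hB : ∀ i ω, |Y i ω| ≤ B) (k : ℕ) (J : ℕ → Finset ℕ) (hJ : ∀ i, (J i).card ≤ k)
    (hcov : ∀ i, ∀ j ∉ J i, ∫ ω, Y i ω * Y j ω ∂P = 0) :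
    ∀ᵐ ω ∂P, Tendsto (fun n : ℕ => 1 / (n : ℝ) * ∑ i ∈ Finset.range n, Y i ω) atTop (𝓝 0) := by
  have hB0 : 0 ≤ B := by
    obtain ⟨ω⟩ := P.nonempty_of_neZero
    exact (abs_nonneg _).trans (hB 0 ω)
  have hYY : ∀ i j ω, |Y i ω * Y j ω| ≤ B ^ 2 := by
    intro i j ω
    rw [abs_mul, sq]
    exact mul_le_mul (hB i ω) (hB j ω) (abs_nonneg _) hB0
  have hint : ∀ i j, Integrable (fun ω => Y i ω * Y j ω) P := fun i j =>
    integrable_of_abs_le ((hm i).mul (hm j)) (hYY i j)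
  set S : ℕ → Ω → ℝ := fun n ω => ∑ i ∈ Finset.range n, Y i ω with hS
  have hSm : ∀ n, Measurable (S n) := fun n => Finset.measurable_sum _ fun i _ => hm i
  have hSq : ∀ n ω, S n ω ^ 2
      = ∑ i ∈ Finset.range n, ∑ j ∈ Finset.range n, Y i ω * Y j ω := by
    intro n ω
    rw [sq, Finset.sum_mul_sum]
  -- For each `i` at most `k` cross terms are nonzero, so the second moment grows linearly.
  have hvar : ∀ n, ∫ ω, S n ω ^ 2 ∂P ≤ n * (k * B ^ 2) := by
    intro n
    simp_rw [hSq]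
    rw [integral_finsetSum _ fun i _ => integrable_finsetSum _ fun j _ => hint i j]
    have h1 : ∀ i ∈ Finset.range n,
        ∫ ω, ∑ j ∈ Finset.range n, Y i ω * Y j ω ∂P ≤ k * B ^ 2 := by
      intro i _
      rw [integral_finsetSum _ fun j _ => hint i j]
      have h2 : ∀ j ∈ Finset.range n,
          ∫ ω, Y i ω * Y j ω ∂P ≤ if j ∈ J i then B ^ 2 else 0 := by
        intro j _
        split_ifs with hj
        · have := integral_mono (hint i j) (integrable_const (B ^ 2))
            fun ω => (le_abs_self _).trans (hYY i j ω)
          simpa using this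
        · exact (hcov i j hj).le
      refine (Finset.sum_le_sum h2).trans ?_
      rw [← Finset.sum_filter, Finset.sum_const, nsmul_eq_mul]
      gcongr
      refine (Finset.card_le_card ?_).trans (hJ i)
      intro j hj
      exact (Finset.mem_filter.1 hj).2
    refine (Finset.sum_le_sum h1).trans ?_
    simp
  -- Along squares the averages have second moment `O(1/m²)`, which is summable; hence the sum of
  -- their squares is almost surely finite and they tend to zero. The shift to `m + 1` avoids
  -- dividing by zero.
  set Z : ℕ → Ω → ENNReal := fun m ω =>
    ENNReal.ofReal ((S ((m + 1) ^ 2) ω / ((m + 1 : ℕ) : ℝ) ^ 2) ^ 2) with hZ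
  have hZm : ∀ m, Measurable (Z m) := fun m =>
    (((hSm _).div_const _).pow_const 2).ennreal_ofReal
  have hZle : ∀ m, ∫⁻ ω, Z m ω ∂P ≤ ENNReal.ofReal (k * B ^ 2 / ((m + 1 : ℕ) : ℝ) ^ 2) := by
    intro m
    have hi : Integrable (fun ω => (S ((m + 1) ^ 2) ω / ((m + 1 : ℕ) : ℝ) ^ 2) ^ 2) P := by
      simp_rw [div_pow, hSq]
      exact (integrable_finsetSum _ fun i _ =>
        integrable_finsetSum _ fun j _ => hint i j).div_const _
    rw [hZ, ← ofReal_integral_eq_lintegral_ofReal hi (ae_of_all _ fun ω => sq_nonneg _)]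
    refine ENNReal.ofReal_le_ofReal ?_
    simp_rw [div_pow]
    rw [integral_div, div_le_div_iff₀ (by positivity) (by positivity)]
    have := hvar ((m + 1) ^ 2)
    push_cast at this ⊢
    have h0 : (0 : ℝ) ≤ ((m : ℝ) + 1) ^ 2 := by positivity
    nlinarith [mul_le_mul_of_nonneg_right this h0]
  have hsum : ∫⁻ ω, ∑' m, Z m ω ∂P ≠ ⊤ := by
    rw [lintegral_tsum fun m => (hZm m).aemeasurable]
    refine ne_top_of_le_ne_top ?_ (ENNReal.tsum_le_tsum hZle)
    have hs : Summable fun m : ℕ => k * B ^ 2 / ((m + 1 : ℕ) : ℝ) ^ 2 := by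
      have := (summable_nat_add_iff 1).2 (Real.summable_one_div_nat_pow.2 one_lt_two)
      simpa [div_eq_mul_inv] using this.mul_left (k * B ^ 2)
    exact hs.tsum_ofReal_ne_top
  filter_upwards [ae_lt_top (Measurable.tsum hZm) hsum] with ω hω
  refine tendsto_div_of_tendsto_sq (a := fun n => S n ω) (B := B) ?_ ?_
  · intro m n hmn
    simp only [hS]
    rw [← Finset.sum_range_add_sum_Ico _ hmn, add_sub_cancel_left]
    refine (Finset.abs_sum_le_sum_abs _ _).trans ?_
    refine (Finset.sum_le_sum fun i _ => hB i ω).trans ?_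
    rw [Finset.sum_const, Nat.card_Ico, nsmul_eq_mul, Nat.cast_sub hmn, mul_comm]
  · rw [← tendsto_add_atTop_iff_nat 1]
    have h1 := ENNReal.tendsto_atTop_zero_of_tsum_ne_top hω.ne
    have h2 := (ENNReal.tendsto_toReal ENNReal.zero_ne_top).comp h1
    have h3 := (Real.continuous_sqrt.tendsto 0).comp h2
    rw [Real.sqrt_zero] at h3
    refine h3.congr fun m => ?_
    simp only [Function.comp_apply, hZ]
    rw [ENNReal.toReal_ofReal (sq_nonneg _), Real.sqrt_sq_eq_abs, abs_div,
      abs_of_nonneg (by positivity : (0 : ℝ) ≤ ((m + 1 : ℕ) : ℝ) ^ 2)]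

end LawOfLargeNumbers

/-! ### The grid enumeration, windows around its points, and averages of local functions. -/

section Grid

variable {d : ℕ}

/-- The box `{-r, …, r}^d`. -/
abbrev Window (d r : ℕ) := ↥(Finset.Icc (fun _ : Fin d => -(r : ℤ)) (fun _ => (r : ℤ)))

/-- The grid point `v_i`, with integer coordinates. -/
def site (v : ℕ → Fin d → ℕ) (i : ℕ) : Fin d → ℤ := fun k => (v i k : ℤ)

/-- All the points of the box of radius `r` around `v_i` are among `v_0, …, v_{n-1}`. -/
def Interior (v : ℕ → Fin d → ℕ) (r n i : ℕ) : Prop :=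
  ∀ u : Window d r, ∃ j < n, site v j = site v i + u

/-- The index of the grid point `v_i + u`. -/
noncomputable def idx (v : ℕ → Fin d → ℕ) (i : ℕ) (u : Fin d → ℤ) : ℕ :=
  -- An arbitrary index when `v_i + u` is not a grid point; the lemmas that identify the site assume
  -- that it is one.
  Function.invFun (site v) (site v i + u)

/-- The first `N ^ d` indices cover a set of exactly `N ^ d` points, so they cannot collide. Both
indices are below `N ≤ N ^ d`, which uses `d ≥ 1`. -/
lemma IsGridEnumeration.injective {v : ℕ → Fin d → ℕ} (hv : IsGridEnumeration v) (hd : 1 ≤ d) :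
    Function.Injective v := by
  intro i j hij
  set N := max i j + 1 with hN
  have hle : N ≤ N ^ d := Nat.le_self_pow (by omega) N
  have himg := hv N (by omega)
  have hcard : (v '' Set.Iio (N ^ d)).ncard = (Set.Iio (N ^ d)).ncard := by
    rw [himg]
    have h1 : {u : Fin d → ℕ | ∀ k, 1 ≤ u k ∧ u k ≤ N}
        = ↑(Fintype.piFinset fun _ : Fin d => Finset.Icc 1 N) := by
      ext u; simp [Pi.le_def, forall_and]
    have h2 : Set.Iio (N ^ d) = ↑(Finset.range (N ^ d)) := by ext; simp
    rw [h1, h2, Set.ncard_coe_finset, Set.ncard_coe_finset]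
    simp
  exact Set.injOn_of_ncard_image_eq hcard (Set.finite_Iio _)
    (lt_of_lt_of_le (by omega) hle) (lt_of_lt_of_le (by omega) hle) hij

lemma site_injective {v : ℕ → Fin d → ℕ} (hv : Function.Injective v) :
    Function.Injective (site v) := by
  intro i j hij
  refine hv (funext fun k => ?_)
  have := congrFun hij k
  simpa [site] using this

lemma idx_eq {v : ℕ → Fin d → ℕ} (hv : Function.Injective v) {i j : ℕ} {u : Fin d → ℤ}
    (h : site v j = site v i + u) : idx v i u = j := by
  rw [idx, ← h, Function.leftInverse_invFun (site_injective hv)]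

lemma site_idx {v : ℕ → Fin d → ℕ} {i : ℕ} {u : Fin d → ℤ}
    (h : ∃ j, site v j = site v i + u) : site v (idx v i u) = site v i + u :=
  Function.invFun_eq h

open Classical in
-- The grid points with all coordinates in `[r + 1, N - r]` are interior, and there are `(N - 2r)^d`
-- of them.
lemma card_interior_ge {v : ℕ → Fin d → ℕ} (hv : IsGridEnumeration v) {r n N : ℕ} (hN : 1 ≤ N)
    (hn : N ^ d ≤ n) :
    (N - 2 * r) ^ d ≤ ((Finset.range n).filter (Interior v r n)).card := by
  have h1 : (Fintype.piFinset fun _ : Fin d => Finset.Icc (r + 1) (N - r))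
      ⊆ ((Finset.range n).filter (Interior v r n)).image v := by
    intro u hu
    rw [Fintype.mem_piFinset] at hu
    have hu' : ∀ k, r + 1 ≤ u k ∧ u k ≤ N - r := fun k => Finset.mem_Icc.1 (hu k)
    have hex : ∀ z : Fin d → ℕ, (∀ k, 1 ≤ z k ∧ z k ≤ N) → ∃ j < n, v j = z := by
      intro z hz
      have : z ∈ v '' Set.Iio (N ^ d) := by rw [hv N hN]; exact hz
      obtain ⟨j, hj, rfl⟩ := this
      exact ⟨j, lt_of_lt_of_le hj hn, rfl⟩
    obtain ⟨i, hi, rfl⟩ := hex u fun k => ⟨by have := hu' k; omega, by have := hu' k; omega⟩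
    refine Finset.mem_image.2 ⟨i, Finset.mem_filter.2 ⟨Finset.mem_range.2 hi, fun w => ?_⟩, rfl⟩
    obtain ⟨w, hw⟩ := w
    rw [Finset.mem_Icc, Pi.le_def, Pi.le_def] at hw
    obtain ⟨j, hj, hjv⟩ := hex (fun k => ((v i k : ℤ) + w k).toNat) fun k => by
      have h2 := hu' k
      have h3 := hw.1 k
      have h4 := hw.2 k
      constructor <;> omega
    refine ⟨j, hj, funext fun k => ?_⟩
    have h2 := hu' k
    have h3 := hw.1 k
    simp only [site, hjv, Pi.add_apply]
    omega
  have h2 := (Finset.card_le_card h1).trans Finset.card_image_le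
  rw [Fintype.card_piFinset_const, Nat.card_Icc] at h2
  refine le_trans (le_of_eq ?_) h2
  congr 1
  omega

open Classical in
/-- The proportion of the points near the boundary of the grid vanishes asymptotically. -/
lemma tendsto_not_interior {v : ℕ → Fin d → ℕ} (hv : IsGridEnumeration v) (hd : 1 ≤ d) (r : ℕ) :
    Tendsto (fun n : ℕ => 1 / (n : ℝ) *
      ((Finset.range n).filter fun i => ¬ Interior v r n i).card) atTop (𝓝 0) := by
  -- `N` is the integer `d`-th root of `n`; at most `(N + 1)^d - (N - 2r)^d` indices are not
  -- interior, which is `o(N^d)`.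
  have hex : ∀ n : ℕ, ∃ N : ℕ, N ^ d ≤ n ∧ n < (N + 1) ^ d := by
    intro n
    have h : ∃ M : ℕ, n < M ^ d := ⟨n + 1, (Nat.lt_succ_self n).trans_le
      (Nat.le_self_pow (by omega) _)⟩
    have h0 : Nat.find h ≠ 0 := by
      intro h0
      have := Nat.find_spec h
      rw [h0, zero_pow (by omega)] at this
      omega
    refine ⟨Nat.find h - 1, not_lt.1 (Nat.find_min h (by omega)), ?_⟩
    rw [Nat.sub_add_cancel (by omega)]
    exact Nat.find_spec h
  choose N hN1 hN2 using hex
  have hNt : Tendsto N atTop atTop := by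
    refine tendsto_atTop.2 fun b => ?_
    filter_upwards [eventually_ge_atTop (b ^ d)] with n hn
    by_contra hlt
    have h1 : (N n + 1) ^ d ≤ b ^ d := Nat.pow_le_pow_left (by omega) d
    have := hN2 n
    omega
  have hlim : Tendsto (fun M : ℕ => (1 + 1 / (M : ℝ)) ^ d - (1 - (2 * r : ℝ) / M) ^ d) atTop
      (𝓝 0) := by
    have h1 : Tendsto (fun M : ℕ => 1 / (M : ℝ)) atTop (𝓝 0) := tendsto_one_div_atTop_nhds_zero_nat
    have h2 := tendsto_const_div_atTop_nhds_zero_nat (2 * r : ℝ)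
    simpa using ((h1.const_add 1).pow d).sub ((h2.const_sub 1).pow d)
  refine squeeze_zero' (Eventually.of_forall fun n => by positivity) ?_ (hlim.comp hNt)
  filter_upwards [hNt.eventually_ge_atTop (2 * r + 1)] with n hn
  have hM0 : (0 : ℝ) < N n := by exact_mod_cast (by omega : 0 < N n)
  have hcard := card_interior_ge hv (r := r) (by omega : 1 ≤ N n) (hN1 n)
  have hsplit := Finset.card_filter_add_card_filter_not (s := Finset.range n) (Interior v r n)
  rw [Finset.card_range] at hsplit
  have hMn : ((N n : ℝ)) ^ d ≤ n := by exact_mod_cast hN1 n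
  have hn0 : (0 : ℝ) < n := lt_of_lt_of_le (by positivity) hMn
  have hnM : (n : ℝ) ≤ ((N n : ℝ) + 1) ^ d := by exact_mod_cast (hN2 n).le
  have hcard' : ((N n : ℝ) - 2 * r) ^ d ≤ ((Finset.range n).filter (Interior v r n)).card := by
    have h1 : ((N n - 2 * r : ℕ) : ℝ) = (N n : ℝ) - 2 * r := by
      rw [Nat.cast_sub (by omega)]; push_cast; ring
    rw [← h1]
    exact_mod_cast hcard
  have hsplit' : (((Finset.range n).filter (Interior v r n)).card : ℝ)
      + ((Finset.range n).filter fun i => ¬ Interior v r n i).card = n := by exact_mod_cast hsplit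
  have hbad : (((Finset.range n).filter fun i => ¬ Interior v r n i).card : ℝ)
      ≤ ((N n : ℝ) + 1) ^ d - ((N n : ℝ) - 2 * r) ^ d := by linarith
  have heq : (1 + 1 / (N n : ℝ)) ^ d - (1 - (2 * r : ℝ) / N n) ^ d
      = (((N n : ℝ) + 1) ^ d - ((N n : ℝ) - 2 * r) ^ d) / (N n : ℝ) ^ d := by
    rw [sub_div, ← div_pow, ← div_pow]
    congr 2 <;> field_simp
  simp only [Function.comp_apply]
  rw [heq, one_div_mul_eq_div]
  have hnn : (0 : ℝ) ≤ ((Finset.range n).filter fun i => ¬ Interior v r n i).card :=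
    Nat.cast_nonneg _
  exact div_le_div₀ (hnn.trans hbad) hbad (by positivity) hMn

/-- The perturbations of the points of the box of radius `r` around `v_i`. -/
noncomputable def patch (v : ℕ → Fin d → ℕ) (r : ℕ) (x : ℕ → E d) (i : ℕ) : Window d r → E d :=
  fun u => x (idx v i u)

variable {Ω : Type*} [MeasurableSpace Ω] {X : ℕ → Ω → E d} {L : Measure (E d)}

lemma indepFun_patch {P : Measure Ω} (hXm : ∀ i, Measurable (X i)) (hXind : iIndepFun X P)
    {v : ℕ → Fin d → ℕ} {r i j : ℕ}
    (hij : ∀ u w : Window d r, idx v i u ≠ idx v j w) :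
    IndepFun (fun ω => patch v r (fun m => X m ω) i) (fun ω => patch v r (fun m => X m ω) j) P := by
  classical
  set S : Finset ℕ := Finset.univ.image fun u : Window d r => idx v i u with hS
  set T : Finset ℕ := Finset.univ.image fun u : Window d r => idx v j u with hT
  have hST : Disjoint S T := by
    rw [Finset.disjoint_left]
    intro a ha hb
    obtain ⟨u, -, hu⟩ := Finset.mem_image.1 ha
    obtain ⟨w, -, hw⟩ := Finset.mem_image.1 hb
    exact hij u w (hu.trans hw.symm)
  have h := hXind.indepFun_finset S T hST hXm
  let f : (S → E d) → Window d r → E d := fun y u =>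
    y ⟨idx v i u, Finset.mem_image_of_mem _ (Finset.mem_univ u)⟩
  let g : (T → E d) → Window d r → E d := fun y u =>
    y ⟨idx v j u, Finset.mem_image_of_mem _ (Finset.mem_univ u)⟩
  exact h.comp (φ := f) (ψ := g) (measurable_pi_lambda _ fun u => measurable_pi_apply _)
    (measurable_pi_lambda _ fun u => measurable_pi_apply _)

variable {P : Measure Ω} [IsProbabilityMeasure P]

lemma idx_injective {v : ℕ → Fin d → ℕ} {r i : ℕ}
    (hi : ∀ u : Window d r, ∃ j, site v j = site v i + u) :
    Function.Injective fun u : Window d r => idx v i u := by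
  intro u w huw
  have h1 := site_idx (hi u)
  have h2 := site_idx (hi w)
  simp only at huw
  rw [huw, h2] at h1
  exact Subtype.ext (add_left_cancel h1).symm

/-- Distinct sites carry distinct i.i.d. variables, so the law of a full patch does not depend on
its centre. -/
lemma map_patch (hXm : ∀ i, Measurable (X i)) (hXind : iIndepFun X P)
    (hXlaw : ∀ i, P.map (X i) = L) {v : ℕ → Fin d → ℕ} {r i : ℕ}
    (hi : ∀ u : Window d r, ∃ j, site v j = site v i + u) :
    P.map (fun ω => patch v r (fun m => X m ω) i) = Measure.pi fun _ => L := by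
  have h := (iIndepFun_iff_map_fun_eq_pi_map fun u : Window d r =>
    (hXm (idx v i u)).aemeasurable).1 (hXind.precomp (idx_injective hi))
  simp only [hXlaw] at h
  exact h

lemma measurable_patch (hXm : ∀ i, Measurable (X i)) (v : ℕ → Fin d → ℕ) (r i : ℕ) :
    Measurable fun ω => patch v r (fun m => X m ω) i :=
  measurable_pi_lambda _ fun _ => hXm _

open Classical in
/-- Averages of a local function over the grid converge almost surely. -/
theorem ae_tendsto_localAverage [IsProbabilityMeasure L] (hd : 1 ≤ d) {v : ℕ → Fin d → ℕ}
    (hv : IsGridEnumeration v)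
    (hXm : ∀ i, Measurable (X i)) (hXind : iIndepFun X P) (hXlaw : ∀ i, P.map (X i) = L)
    {r : ℕ} {H : (Window d r → E d) → ℝ} (hH : Measurable H) {B : ℝ} (hB : ∀ y, |H y| ≤ B) :
    ∀ᵐ ω ∂P, Tendsto (fun n : ℕ => 1 / (n : ℝ) * ∑ i ∈ Finset.range n,
      if Interior v r n i then H (patch v r (fun m => X m ω) i) else 0) atTop
      (𝓝 (∫ y, H y ∂Measure.pi fun _ => L)) := by
  set m := ∫ y, H y ∂Measure.pi (fun _ : Window d r => L) with hm
  have hinj := hv.injective hd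
  -- Unlike `Interior`, this does not involve `n`, so `Y` is one fixed sequence to which the law of
  -- large numbers applies.
  let Inner : ℕ → Prop := fun i => ∀ u : Window d r, ∃ j, site v j = site v i + u
  set Y : ℕ → Ω → ℝ := fun i ω =>
    if Inner i then H (patch v r (fun m => X m ω) i) - m else 0 with hY
  have hHm : ∀ i, Measurable fun ω => H (patch v r (fun m => X m ω) i) := fun i =>
    hH.comp (measurable_patch hXm v r i)
  have hmB : |m| ≤ B := by
    have := norm_integral_le_of_norm_le_const (μ := Measure.pi fun _ : Window d r => L)
      (ae_of_all _ fun y => (Real.norm_eq_abs _).trans_le (hB y))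
    simpa using this
  have hB0 : 0 ≤ B := (abs_nonneg _).trans hmB
  have hYm : ∀ i, Measurable (Y i) := by
    intro i
    by_cases hi : Inner i
    · simpa [hY, hi] using (hHm i).sub_const m
    · simp [hY, hi]
  have hYB : ∀ i ω, |Y i ω| ≤ 2 * B := by
    intro i ω
    by_cases hi : Inner i
    · simp only [hY, hi, if_true]
      exact (abs_sub _ _).trans (by linarith [hB (patch v r (fun m => X m ω) i)])
    · simpa [hY, hi] using hB0
  have hY0 : ∀ i, ∫ ω, Y i ω ∂P = 0 := by
    intro i
    by_cases hi : Inner i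
    · simp only [hY, hi, if_true]
      rw [integral_sub (integrable_of_abs_le (hHm i) fun ω => hB _) (integrable_const _)]
      rw [← integral_map (measurable_patch hXm v r i).aemeasurable hH.aestronglyMeasurable,
        map_patch hXm hXind hXlaw hi]
      simp [hm]
    · simp [hY, hi]
  -- Two windows of radius `r` can share a site only if their centres differ by a vector in the box
  -- of radius `2r`.
  let J : ℕ → Finset ℕ := fun i => (Finset.Icc (fun _ : Fin d => -((2 * r : ℕ) : ℤ))
    (fun _ => ((2 * r : ℕ) : ℤ))).image (idx v i)
  have hcov : ∀ i, ∀ j ∉ J i, ∫ ω, Y i ω * Y j ω ∂P = 0 := by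
    intro i j hj
    by_cases hi' : Inner i
    swap
    · simp [hY, hi']
    by_cases hj' : Inner j
    swap
    · simp [hY, hj']
    have hne : ∀ u w : Window d r, idx v i u ≠ idx v j w := by
      intro u w huw
      refine hj (Finset.mem_image.2 ⟨u - w, ?_, idx_eq hinj ?_⟩)
      · have hu := Finset.mem_Icc.1 u.2
        have hw := Finset.mem_Icc.1 w.2
        rw [Pi.le_def, Pi.le_def] at hu hw
        rw [Finset.mem_Icc, Pi.le_def, Pi.le_def]
        refine ⟨fun k => ?_, fun k => ?_⟩ <;>
        · have h1 := hu.1 k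
          have h2 := hu.2 k
          have h3 := hw.1 k
          have h4 := hw.2 k
          simp only [Pi.sub_apply] at h1 h2 h3 h4 ⊢
          push_cast
          omega
      · have h1 := site_idx (hi' u)
        have h2 := site_idx (hj' w)
        rw [huw, h2] at h1
        rw [← add_sub_assoc, ← h1, add_sub_cancel_right]
    have hind := (indepFun_patch hXm hXind hne).comp (φ := fun y => H y - m)
      (ψ := fun y => H y - m) (hH.sub_const m) (hH.sub_const m)
    have h1 := hind.integral_mul_eq_mul_integral
      ((hHm i).sub_const m).aestronglyMeasurable ((hHm j).sub_const m).aestronglyMeasurable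
    have h2 := hY0 i
    simp only [hY, hi', hj', if_true] at h2 ⊢
    refine h1.trans ?_
    refine mul_eq_zero_of_left ?_ _
    exact h2
  filter_upwards [ae_tendsto_average_zero hYm hYB _ J (fun i => Finset.card_image_le) hcov]
    with ω hω
  have hbad := (tendsto_not_interior hv hd r).const_mul B
  rw [mul_zero] at hbad
  -- The summand is zero at interior indices and at most `4B` elsewhere, so the vanishing proportion
  -- of boundary indices suffices.
  have hrest : Tendsto (fun n : ℕ => 1 / (n : ℝ) * ∑ i ∈ Finset.range n,
      ((if Interior v r n i then H (patch v r (fun m => X m ω) i) else 0) - m - Y i ω))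
      atTop (𝓝 0) := by
    refine squeeze_zero_norm (fun n => ?_) (by simpa using hbad.const_mul 4)
    rw [norm_mul, Real.norm_of_nonneg (by positivity : (0 : ℝ) ≤ 1 / (n : ℝ))]
    have h1 : ‖∑ i ∈ Finset.range n,
        ((if Interior v r n i then H (patch v r (fun m => X m ω) i) else 0) - m - Y i ω)‖
        ≤ ∑ i ∈ Finset.range n, if ¬ Interior v r n i then 4 * B else 0 := by
      refine (norm_sum_le _ _).trans (Finset.sum_le_sum fun i _ => ?_)
      by_cases hi : Interior v r n i
      · have hi' : Inner i := fun u => (hi u).imp fun j hj => hj.2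
        simp [hY, hi, hi']
      · simp only [hi, if_false, not_false_eq_true, if_true, Real.norm_eq_abs]
        rw [zero_sub]
        refine (abs_sub _ _).trans ?_
        rw [abs_neg]
        linarith [hYB i ω]
    rw [← Finset.sum_filter, Finset.sum_const, nsmul_eq_mul] at h1
    calc _ ≤ 1 / (n : ℝ) * (_ * (4 * B)) := mul_le_mul_of_nonneg_left h1 (by positivity)
      _ = _ := by ring
  have htot := (hω.add hrest).add_const m
  rw [zero_add, zero_add] at htot
  refine htot.congr' ?_
  filter_upwards [eventually_ge_atTop 1] with n hn
  have hn0 : (n : ℝ) ≠ 0 := by positivity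
  rw [← mul_add, ← Finset.sum_add_distrib]
  have h1 : ∀ i, Y i ω
      + ((if Interior v r n i then H (patch v r (fun m => X m ω) i) else 0) - m - Y i ω)
      = (if Interior v r n i then H (patch v r (fun m => X m ω) i) else 0) - m := fun i => by ring
  simp_rw [h1]
  rw [Finset.sum_sub_distrib, Finset.sum_const, Finset.card_range, nsmul_eq_mul]
  field_simp
  ring

end Grid

/-! ### Summable lattice kernels dominating the matrices, and their commutators with cutoffs. -/

section Kernel

variable {d : ℕ}

/-- The weights `((1 - 2ε)‖u‖)^{-(d+1)}` on the lattice, vanishing at the origin. -/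
noncomputable def latticeWeight (d : ℕ) (ε : ℝ) (u : Fin d → ℤ) : ℝ :=
  (((1 - 2 * ε) * ‖u‖) ^ (d + 1))⁻¹

/-- The weights `latticeWeight`, with the value `1` at the origin. -/
noncomputable def latticeKernel (d : ℕ) (ε : ℝ) (u : Fin d → ℤ) : ℝ :=
  (if u = 0 then 1 else 0) + latticeWeight d ε u

lemma norm_intCast_pi (u : Fin d → ℤ) : ‖fun k => (u k : ℝ)‖ = ‖u‖ := by
  simp only [Pi.norm_def]
  congr 2

/-- The exponent `d + 1` exceeds the rank `d` of the lattice. -/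
lemma summable_latticeWeight (d : ℕ) (ε : ℝ) : Summable (latticeWeight d ε) := by
  let b := Pi.basisFun ℝ (Fin d)
  let L : Submodule ℤ (Fin d → ℝ) := Submodule.span ℤ (Set.range b)
  have hrank : Module.finrank ℤ L < d + 1 := by
    rw [ZLattice.rank ℝ L]; simp
  have hs := ZLattice.summable_norm_pow_inv L (d + 1) hrank
  have hmem : ∀ u : Fin d → ℤ, (fun k => (u k : ℝ)) ∈ L := by
    intro u
    have h : (fun k => (u k : ℝ)) = ∑ k, u k • b k := by
      ext j
      simp [b, Finset.sum_apply, Pi.single_apply]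
    rw [h]
    exact Submodule.sum_mem _ fun k _ =>
      Submodule.smul_mem _ _ (Submodule.subset_span (Set.mem_range_self k))
  let f : (Fin d → ℤ) → L := fun u => ⟨_, hmem u⟩
  have hf : Function.Injective f := by
    intro u w huw
    ext k
    have : (u k : ℝ) = w k := congrFun (congrArg Subtype.val huw) k
    exact_mod_cast this
  have h1 := (hs.comp_injective hf).mul_left (((1 - 2 * ε) ^ (d + 1))⁻¹)
  refine h1.congr fun u => ?_
  rw [latticeWeight, mul_pow, mul_inv]
  simp [f, norm_intCast_pi]

lemma summable_latticeKernel (d : ℕ) (ε : ℝ) : Summable (latticeKernel d ε) :=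
  (summable_of_hasFiniteSupport ((Set.finite_singleton (0 : Fin d → ℤ)).subset
    (by intro u; simp))).add (summable_latticeWeight d ε)

lemma latticeWeight_nonneg {ε : ℝ} (hε : ε < 1 / 2) (u : Fin d → ℤ) : 0 ≤ latticeWeight d ε u := by
  have : 0 ≤ 1 - 2 * ε := by linarith
  unfold latticeWeight
  positivity

lemma latticeKernel_nonneg {ε : ℝ} (hε : ε < 1 / 2) (u : Fin d → ℤ) : 0 ≤ latticeKernel d ε u :=
  add_nonneg (by split_ifs <;> norm_num) (latticeWeight_nonneg hε u)

/-- The coordinates of the point lie in `[-1, 1]`. -/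
def InCube (x : E d) : Prop := ∀ k, |x k| ≤ 1

/-- A nonzero coordinate satisfies `|u k| ≥ 1` and moves by at most `2ε ≤ 2ε |u k|`. The norm on the
left is the supremum norm, and the Euclidean norm dominates each coordinate. -/
lemma norm_latticePoint_add_ge {ε : ℝ} (hε : 0 ≤ ε) (hε' : ε < 1 / 2) (u : Fin d → ℤ)
    {x y : E d} (hx : InCube x) (hy : InCube y) :
    (1 - 2 * ε) * ‖u‖ ≤ ‖latticePoint u + ε • (x - y)‖ := by
  have h0 : 0 < 1 - 2 * ε := by linarith
  rw [mul_comm, ← le_div_iff₀ h0, pi_norm_le_iff_of_nonneg (by positivity)]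
  intro k
  rw [le_div_iff₀ h0]
  by_cases hk : u k = 0
  · rw [hk]; simp
  refine le_trans ?_ (PiLp.norm_apply_le _ k)
  have h1 : (1 : ℝ) ≤ |(u k : ℝ)| := by exact_mod_cast Int.one_le_abs hk
  have h2 : (latticePoint u + ε • (x - y)) k = u k + ε * (x k - y k) := by
    simp [latticePoint]
  rw [h2, Int.norm_eq_abs, Real.norm_eq_abs]
  have h3 : |ε * (x k - y k)| ≤ 2 * ε := by
    rw [abs_mul, abs_of_nonneg hε]
    have := (abs_sub (x k) (y k)).trans (add_le_add (hx k) (hy k))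
    nlinarith
  have h4 := abs_sub_abs_le_abs_sub (u k : ℝ) (-(ε * (x k - y k)))
  rw [abs_neg, sub_neg_eq_add] at h4
  nlinarith

lemma abs_le_latticeKernel {ε : ℝ} (hε : 0 ≤ ε) (hε' : ε < 1 / 2) {g : E d → ℝ} {C : ℝ}
    (hg : ∀ t, |g t| ≤ C / (1 + ‖t‖ ^ (d + 1))) (u : Fin d → ℤ)
    {x y : E d} (hx : InCube x) (hy : InCube y) :
    |g (latticePoint u + ε • (x - y))| ≤ C * latticeKernel d ε u := by
  have h0 : 0 < 1 - 2 * ε := by linarith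
  have hC : 0 ≤ C := by
    have := (abs_nonneg _).trans (hg 0)
    simpa using this
  set t := latticePoint u + ε • (x - y)
  refine (hg t).trans ?_
  rw [div_eq_mul_inv]
  refine mul_le_mul_of_nonneg_left ?_ hC
  by_cases hu : u = 0
  · rw [latticeKernel, if_pos hu]
    refine le_trans ?_ (le_add_of_nonneg_right (latticeWeight_nonneg hε' u))
    exact inv_le_one_of_one_le₀ (le_add_of_nonneg_right (by positivity))
  · rw [latticeKernel, if_neg hu, zero_add, latticeWeight]
    have hu' : 0 < ‖u‖ := norm_pos_iff.2 hu
    refine inv_anti₀ (by positivity) ?_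
    refine (pow_le_pow_left₀ (by positivity) (norm_latticePoint_add_ge hε hε' u hx hy) _).trans ?_
    linarith

/-- Each row or column sum runs over distinct lattice vectors, so Schur's test gives a bound
independent of the size of the matrix. -/
lemma opBound_of_kernel {ι : Type*} [Fintype ι] {z : ι → Fin d → ℤ} (hz : Function.Injective z)
    {κ : (Fin d → ℤ) → ℝ} (hκ : ∀ u, 0 ≤ κ u) (hs : Summable κ) {Q : Matrix ι ι ℝ}
    (hQ : ∀ i j, |Q i j| ≤ κ (z i - z j)) : OpBound (∑' u, κ u) Q := by
  refine opBound_of_row_col (tsum_nonneg hκ) hQ (fun i => ?_) fun j => ?_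
  · rw [← tsum_fintype (L := .unconditional _)]
    exact tsum_comp_le_tsum_of_inj hs hκ (i := fun j => z i - z j) fun a b h =>
      hz (sub_right_injective h)
  · rw [← tsum_fintype (L := .unconditional _)]
    exact tsum_comp_le_tsum_of_inj hs hκ (i := fun i => z i - z j) fun a b h =>
      hz (sub_left_injective h)

/-- A slowly varying weight, which vanishes at the origin and is `1` far from it. -/
noncomputable def cutoff (s : ℝ) (u : Fin d → ℤ) : ℝ := min 1 (‖u‖ / s)

lemma cutoff_nonneg {s : ℝ} (hs : 0 < s) (u : Fin d → ℤ) : 0 ≤ cutoff s u :=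
  le_min zero_le_one (by positivity)

/-- This dominates the commutator with a cutoff centred anywhere by a translation-invariant kernel.
-/
lemma abs_cutoff_sub_le {s : ℝ} (hs : 0 < s) (u w : Fin d → ℤ) :
    |cutoff s u - cutoff s w| ≤ cutoff s (u - w) := by
  refine le_min ?_ ?_
  · have h1 := cutoff_nonneg hs u
    have h2 := cutoff_nonneg hs w
    have h3 : cutoff s u ≤ 1 := min_le_left _ _
    have h4 : cutoff s w ≤ 1 := min_le_left _ _
    exact abs_sub_le_iff.2 ⟨by linarith, by linarith⟩
  · refine (abs_min_sub_min_le_max _ _ _ _).trans ?_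
    rw [sub_self, abs_zero, ← sub_div, abs_div, abs_of_pos hs]
    refine max_le (by positivity) ?_
    gcongr
    exact abs_norm_sub_norm_le u w

/-- A bound for the commutator of a dominated matrix with a cutoff. -/
noncomputable def cutoffSum (d : ℕ) (ε s : ℝ) : ℝ :=
  ∑' u : Fin d → ℤ, cutoff s u * latticeKernel d ε u

lemma summable_cutoff {ε s : ℝ} (hε' : ε < 1 / 2) (hs : 0 < s) :
    Summable fun u : Fin d → ℤ => cutoff s u * latticeKernel d ε u :=
  Summable.of_nonneg_of_le
    (fun u => mul_nonneg (cutoff_nonneg hs u) (latticeKernel_nonneg hε' u))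
    (fun u => mul_le_of_le_one_left (latticeKernel_nonneg hε' u) (min_le_left _ _))
    (summable_latticeKernel d ε)

/-- For fixed `u` the cutoff tends to zero as its scale grows; dominated convergence does the rest.
Wide cutoffs thus almost commute with the matrices. -/
lemma tendsto_cutoffSum {ε : ℝ} (hε' : ε < 1 / 2) :
    Tendsto (fun r : ℕ => cutoffSum d ε r) atTop (𝓝 0) := by
  have h : Tendsto (fun r : ℕ => cutoffSum d ε r) atTop (𝓝 (∑' _ : Fin d → ℤ, (0 : ℝ))) := by
    refine tendsto_tsum_of_dominated_convergence (summable_latticeKernel d ε) (fun u => ?_) ?_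
    · have h1 := tendsto_const_div_atTop_nhds_zero_nat ‖u‖
      have h2 := ((tendsto_const_nhds (x := (1 : ℝ))).min h1).mul_const (latticeKernel d ε u)
      simpa [cutoff] using h2
    · filter_upwards [eventually_ge_atTop 1] with r hr u
      have hr' : (0 : ℝ) < r := by exact_mod_cast hr
      rw [Real.norm_of_nonneg (mul_nonneg (cutoff_nonneg hr' u) (latticeKernel_nonneg hε' u))]
      exact mul_le_of_le_one_left (latticeKernel_nonneg hε' u) (min_le_left _ _)
  simpa using h

lemma commBound_of_kernel {ι : Type*} [Fintype ι] {z : ι → Fin d → ℤ} (hz : Function.Injective z)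
    {ε s C : ℝ} (hε' : ε < 1 / 2) (hs : 0 < s) (hC : 0 ≤ C) {Q : Matrix ι ι ℝ}
    (hQ : ∀ i j, |Q i j| ≤ C * latticeKernel d ε (z i - z j)) (a : Fin d → ℤ) :
    CommBound (fun i => cutoff s (z i - a)) (C * cutoffSum d ε s) Q := by
  have hκ : ∀ u : Fin d → ℤ, 0 ≤ C * (cutoff s u * latticeKernel d ε u) := fun u =>
    mul_nonneg hC (mul_nonneg (cutoff_nonneg hs u) (latticeKernel_nonneg hε' u))
  have hsum : Summable fun u : Fin d → ℤ => C * (cutoff s u * latticeKernel d ε u) :=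
    (summable_cutoff hε' hs).mul_left C
  rw [cutoffSum, ← tsum_mul_left]
  refine commBound_of_row_col
    (q := Matrix.of fun i j => C * (cutoff s (z i - z j) * latticeKernel d ε (z i - z j)))
    (tsum_nonneg hκ) (fun i j => ?_) (fun i => ?_) fun j => ?_
  · rw [abs_mul, Matrix.of_apply]
    have h1 := abs_cutoff_sub_le hs (z i - a) (z j - a)
    rw [sub_sub_sub_cancel_right] at h1
    calc _ ≤ cutoff s (z i - z j) * (C * latticeKernel d ε (z i - z j)) :=
          mul_le_mul h1 (hQ i j) (abs_nonneg _) (cutoff_nonneg hs _)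
      _ = _ := by ring
  · rw [← tsum_fintype (L := .unconditional _)]
    exact tsum_comp_le_tsum_of_inj hsum hκ (i := fun j => z i - z j) fun a b h =>
      hz (sub_right_injective h)
  · rw [← tsum_fintype (L := .unconditional _)]
    exact tsum_comp_le_tsum_of_inj hsum hκ (i := fun i => z i - z j) fun a b h =>
      hz (sub_left_injective h)

end Kernel

/-! ### Uniform coercivity from a positive spectral density. -/

section Fourier

variable {d : ℕ}

/-- The character `e^{i f·t}`. -/
noncomputable def character (f t : E d) : ℂ := Complex.exp (Complex.I * ((inner ℝ f t : ℝ) : ℂ))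

lemma norm_character (f t : E d) : ‖character f t‖ = 1 := by
  rw [character, mul_comm, Complex.norm_exp_ofReal_mul_I]

lemma continuous_character (t : E d) : Continuous fun f => character f t := by
  unfold character; fun_prop

lemma continuous_character_right (f : E d) : Continuous fun t => character f t := by
  unfold character; fun_prop

lemma character_sub (f s t : E d) :
    character f (s - t) = character f s * (starRingEnd ℂ) (character f t) := by
  rw [character, character, character, ← Complex.exp_conj, ← Complex.exp_add, inner_sub_right]
  congr 1
  simp
  ring

lemma integrable_mul_character {g : E d → ℝ} (hg : Integrable g) (t : E d) :
    Integrable fun f => (g f : ℂ) * character f t :=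
  hg.ofReal.mul_bdd (c := 1) (continuous_character t).aestronglyMeasurable
    (ae_of_all _ fun f => (norm_character f t).le)

/-- The quadratic form of a Fourier integral. -/
lemma sum_integral_character {ι : Type*} [Fintype ι] {g : E d → ℝ} (hg : Integrable g)
    (y : ι → ℝ) (t : ι → E d) :
    ∑ i, ∑ j, (y i : ℂ) * y j * ∫ f, (g f : ℂ) * character f (t i - t j)
      = ((∫ f, g f * ‖∑ i, (y i : ℂ) * character f (t i)‖ ^ 2 : ℝ) : ℂ) := by
  rw [← integral_complex_ofReal]
  simp_rw [← integral_const_mul]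
  have hint : ∀ i j, Integrable fun f =>
      (y i : ℂ) * y j * ((g f : ℂ) * character f (t i - t j)) := fun i j =>
    (integrable_mul_character hg _).const_mul _
  simp_rw [← integral_finsetSum Finset.univ fun j _ => hint _ j]
  rw [← integral_finsetSum _ fun i _ => integrable_finsetSum _ fun j _ => hint i j]
  refine integral_congr_ae (ae_of_all _ fun f => ?_)
  simp only
  push_cast
  rw [← Complex.mul_conj', map_sum, Finset.sum_mul_sum, Finset.mul_sum]
  refine Finset.sum_congr rfl fun i _ => ?_
  rw [Finset.mul_sum]
  refine Finset.sum_congr rfl fun j _ => ?_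
  rw [character_sub, map_mul, Complex.conj_ofReal]
  ring

lemma integrable_mul_norm_sq {ι : Type*} [Fintype ι] {g : E d → ℝ} (hg : Integrable g)
    (y : ι → ℝ) (t : ι → E d) :
    Integrable fun f => g f * ‖∑ i, (y i : ℂ) * character f (t i)‖ ^ 2 := by
  refine hg.mul_bdd (c := (∑ i, |y i|) ^ 2) ?_ (ae_of_all _ fun f => ?_)
  · refine Continuous.aestronglyMeasurable ?_
    have : ∀ i, Continuous fun f => character f (t i) := fun i => continuous_character _
    fun_prop
  · rw [norm_pow, norm_norm]
    refine pow_le_pow_left₀ (norm_nonneg _) ?_ 2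
    refine (norm_sum_le _ _).trans (Finset.sum_le_sum fun i _ => ?_)
    rw [norm_mul, norm_character, mul_one, Complex.norm_real, Real.norm_eq_abs]

/-- The Fourier integral of a bump function decays quickly. -/
lemma exists_bump_decay (d : ℕ) : ∃ w : E d → ℝ, Continuous w ∧ Integrable w ∧ (∀ f, 0 ≤ w f) ∧
    (∀ f, w f ≤ 1) ∧ (∀ f, w f ≠ 0 → ‖f‖ < 2) ∧ 0 < ∫ f, w f ∧ ∃ C, 0 < C ∧
      ∀ t : E d, ‖t‖ ^ (d + 1) * ‖∫ f, (w f : ℂ) * character f t‖ ≤ C := by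
  let w : ContDiffBump (0 : E d) := ⟨1, 2, one_pos, one_lt_two⟩
  have hcs : HasCompactSupport fun f => (w f : ℂ) :=
    w.hasCompactSupport.comp_left Complex.ofReal_zero
  have hsm : ContDiff ℝ ((⊤ : ℕ∞) : WithTop ℕ∞) fun f => (w f : ℂ) :=
    Complex.ofRealCLM.contDiff.comp w.contDiff
  -- A smooth compactly supported function is Schwartz, hence so is its Fourier transform. The
  -- `e^{-2πi}` convention accounts for the argument `-t/(2π)` and the factor `(2π)^(d+1)`.
  let W : SchwartzMap (E d) ℂ := hcs.toSchwartzMap hsm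
  obtain ⟨C, hC, hdec⟩ := (FourierTransform.fourier W).decay (d + 1) 0
  refine ⟨w, w.continuous, w.continuous.integrable_of_hasCompactSupport w.hasCompactSupport,
    fun f => w.nonneg, fun f => w.le_one, fun f hf => ?_, w.integral_pos,
    (2 * Real.pi) ^ (d + 1) * C, by positivity, fun t => ?_⟩
  · have : f ∈ Function.support w := hf
    rw [w.support_eq] at this
    simpa using this
  · have h1 : ∫ f, (w f : ℂ) * character f t
        = FourierTransform.fourier W (-(2 * Real.pi)⁻¹ • t) := by
      rw [SchwartzMap.fourier_coe, Real.fourier_eq']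
      refine integral_congr_ae (ae_of_all _ fun f => ?_)
      simp only [smul_eq_mul]
      rw [mul_comm, character, inner_smul_right]
      congr 2
      have hpi : (Real.pi : ℂ) ≠ 0 := by exact_mod_cast Real.pi_ne_zero
      push_cast
      field_simp
    have h2 := hdec (-(2 * Real.pi)⁻¹ • t)
    rw [norm_iteratedFDeriv_zero, ← h1, norm_smul, mul_pow, norm_neg, norm_inv,
      Real.norm_of_nonneg (by positivity : 0 ≤ 2 * Real.pi), inv_pow, mul_assoc,
      inv_mul_le_iff₀ (by positivity)] at h2
    exact h2

/-- Widening the bump by `M` amounts to spreading the points by `M`, which makes the off-diagonal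
Gram entries small relative to the diagonal ones. -/
lemma integral_bump_scale (w : E d → ℝ) {M : ℝ} (hM : 0 < M) (t : E d) :
    ∫ f, (w (M⁻¹ • f) : ℂ) * character f t
      = ((M ^ d : ℝ) : ℂ) * ∫ f, (w f : ℂ) * character f (M • t) := by
  have h := Measure.integral_comp_inv_smul (volume : Measure (E d))
    (fun f => (w f : ℂ) * character f (M • t)) M
  have h1 : ∀ f : E d, character (M⁻¹ • f) (M • t) = character f t := by
    intro f
    rw [character, character, real_inner_smul_left, real_inner_smul_right,
      inv_mul_cancel_left₀ hM.ne']
  simp only [h1] at h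
  rw [h, finrank_euclideanSpace_fin, abs_of_pos (by positivity), Complex.real_smul]

/-- A stationary covariance function with a continuous positive spectral density is uniformly
coercive on perturbed grids. -/
theorem exists_coercive {k h : E d → ℝ} (hcont : Continuous h) (hpos : ∀ f, 0 < h f)
    (hint : Integrable h) (hk : ∀ t, (k t : ℂ) = ∫ f, (h f : ℂ) * character f t)
    {ε : ℝ} (hε : 0 ≤ ε) (hε' : ε < 1 / 2) :
    ∃ c > 0, ∀ {ι : Type} [Fintype ι] (z : ι → Fin d → ℤ) (x : ι → E d),
      Function.Injective z → (∀ i, InCube (x i)) →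
      Coercive c (Matrix.of fun i j =>
        k ((latticePoint (z i) + ε • x i) - (latticePoint (z j) + ε • x j))) := by
  obtain ⟨w, hwc, hwi, hw0, hw1, hws, hwp, C, hC, hdec⟩ := exists_bump_decay d
  set m := ∫ f, w f with hm
  set T := ∑' u : Fin d → ℤ, latticeWeight d ε u with hT
  have hT0 : 0 ≤ T := tsum_nonneg (latticeWeight_nonneg hε')
  -- Chosen so that the off-diagonal part, of norm at most `C T / M^(d+1)`, is at most half the
  -- diagonal value `m`.
  set M := max 1 (2 * C * T / m) with hM
  have hM1 : 1 ≤ M := le_max_left _ _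
  have hM0 : 0 < M := zero_lt_one.trans_le hM1
  have hMT : C / M ^ (d + 1) * T ≤ m / 2 := by
    have h1 : 2 * C * T / m ≤ M := le_max_right _ _
    have h2 : M ≤ M ^ (d + 1) := le_self_pow₀ hM1 (by omega)
    rw [div_le_iff₀ hwp] at h1
    rw [div_mul_eq_mul_div, div_le_iff₀ (by positivity)]
    nlinarith
  -- The dilated bump is supported in this ball, so the minimum of `h` there gives `δ w(f/M) ≤ h f`
  -- everywhere.
  obtain ⟨f₀, -, hf₀⟩ := (isCompact_closedBall (0 : E d) (2 * M)).exists_isMinOn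
    ⟨0, Metric.mem_closedBall_self (by positivity)⟩ hcont.continuousOn
  set δ := h f₀ with hδ
  have hδ0 : 0 < δ := hpos _
  have hle : ∀ f, δ * w (M⁻¹ • f) ≤ h f := by
    intro f
    by_cases hf : w (M⁻¹ • f) = 0
    · rw [hf, mul_zero]; exact (hpos f).le
    · have h1 := hws _ hf
      rw [norm_smul, norm_inv, Real.norm_of_nonneg hM0.le, inv_mul_lt_iff₀ hM0] at h1
      have h2 : δ ≤ h f := hf₀ (by
        rw [mem_closedBall_zero_iff]; linarith)
      exact (mul_le_of_le_one_right hδ0.le (hw1 _)).trans h2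
  refine ⟨δ * (M ^ d * (m / 2)), by positivity, ?_⟩
  intro ι _ z x hz hx y
  classical
  set t : ι → E d := fun i => latticePoint (z i) + ε • x i with ht
  have hwMi : Integrable fun f : E d => w (M⁻¹ • f) := hwi.comp_smul (inv_ne_zero hM0.ne')
  set F : E d → ℂ := fun s => ∫ f, (w f : ℂ) * character f s with hF
  have hF0 : F 0 = (m : ℂ) := by
    simp [hF, character, integral_complex_ofReal, hm]
  have htt : ∀ i j, t i - t j = latticePoint (z i - z j) + ε • (x i - x j) := by
    intro i j
    ext a
    simp [ht, latticePoint]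
    ring
  -- the form of `k` dominates the form of the rescaled bump
  have hform : y ⬝ᵥ (Matrix.of fun i j => k (t i - t j)) *ᵥ y
      = ∫ f, h f * ‖∑ i, (y i : ℂ) * character f (t i)‖ ^ 2 := by
    have h1 := sum_integral_character hint y t
    simp_rw [← hk] at h1
    have h2 : (y ⬝ᵥ (Matrix.of fun i j => k (t i - t j)) *ᵥ y)
        = ∑ i, ∑ j, y i * y j * k (t i - t j) := by
      simp only [dotProduct, Matrix.mulVec, Matrix.of_apply, Finset.mul_sum]
      exact Finset.sum_congr rfl fun i _ => Finset.sum_congr rfl fun j _ => by ring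
    rw [h2]
    exact_mod_cast h1
  have hmono : δ * ∫ f, w (M⁻¹ • f) * ‖∑ i, (y i : ℂ) * character f (t i)‖ ^ 2
      ≤ ∫ f, h f * ‖∑ i, (y i : ℂ) * character f (t i)‖ ^ 2 := by
    rw [← integral_const_mul]
    refine integral_mono ((integrable_mul_norm_sq hwMi y t).const_mul δ)
      (integrable_mul_norm_sq hint y t) fun f => ?_
    simp only
    rw [← mul_assoc]
    exact mul_le_mul_of_nonneg_right (hle f) (sq_nonneg _)
  -- the form of the rescaled bump
  let Q : Matrix ι ι ℝ := Matrix.of fun i j => if i = j then 0 else ‖F (M • (t i - t j))‖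
  have hQ : OpBound (C / M ^ (d + 1) * T) Q := by
    have h1 := opBound_of_kernel (Q := Q) hz
      (κ := fun u => C / M ^ (d + 1) * latticeWeight d ε u)
      (fun u => mul_nonneg (by positivity) (latticeWeight_nonneg hε' u))
      ((summable_latticeWeight d ε).mul_left _) (fun i j => ?_)
    · rwa [tsum_mul_left] at h1
    · by_cases hij : i = j
      · simp only [Q, Matrix.of_apply, hij, if_true, abs_zero]
        exact mul_nonneg (by positivity) (latticeWeight_nonneg hε' _)
      · simp only [Q, Matrix.of_apply, hij, if_false, abs_norm]
        have h2 := hdec (M • (t i - t j))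
        rw [norm_smul, Real.norm_of_nonneg hM0.le, mul_pow] at h2
        have h3 := norm_latticePoint_add_ge hε hε' (z i - z j) (hx i) (hx j)
        rw [← htt] at h3
        have h4 : 0 < (1 - 2 * ε) * ‖z i - z j‖ :=
          mul_pos (by linarith) (norm_pos_iff.2 (sub_ne_zero.2 fun h => hij (hz h)))
        have h5 := pow_le_pow_left₀ h4.le h3 (d + 1)
        rw [latticeWeight, ← div_eq_mul_inv, div_div, le_div_iff₀ (by positivity), mul_comm]
        refine le_trans ?_ h2
        exact mul_le_mul_of_nonneg_right (mul_le_mul_of_nonneg_left h5 (by positivity))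
          (norm_nonneg _)
  have hbump : M ^ d * (m / 2) * l2 y ^ 2
      ≤ ∫ f, w (M⁻¹ • f) * ‖∑ i, (y i : ℂ) * character f (t i)‖ ^ 2 := by
    have h1 := sum_integral_character hwMi y t
    simp_rw [integral_bump_scale w hM0] at h1
    have h2 := congrArg Complex.re h1
    rw [Complex.ofReal_re] at h2
    rw [← h2]
    have h3 : (∑ i, ∑ j, (y i : ℂ) * y j * (((M ^ d : ℝ) : ℂ) * F (M • (t i - t j)))).re
        = M ^ d * ∑ i, ∑ j, y i * y j * (F (M • (t i - t j))).re := by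
      simp only [Complex.re_sum, Finset.mul_sum]
      refine Finset.sum_congr rfl fun i _ => Finset.sum_congr rfl fun j _ => ?_
      rw [← mul_assoc, ← Complex.ofReal_mul, ← Complex.ofReal_mul, Complex.re_ofReal_mul]
      ring
    rw [h3, mul_assoc]
    refine mul_le_mul_of_nonneg_left ?_ (by positivity)
    -- Diagonal dominance: off-diagonal terms are replaced by minus their absolute values, and their
    -- sum is the form of `Q` at `|y|`, at most `(m/2) |y|²`.
    have h4 : ∀ i j, (if i = j then m * y i ^ 2 else 0) - |y i| * (Q i j * |y j|)
        ≤ y i * y j * (F (M • (t i - t j))).re := by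
      intro i j
      by_cases hij : i = j
      · subst hij
        simp only [Q, Matrix.of_apply, if_true, sub_self, smul_zero, hF0, Complex.ofReal_re]
        nlinarith
      · simp only [Q, Matrix.of_apply, hij, if_false, zero_sub]
        have h5 := Complex.abs_re_le_norm (F (M • (t i - t j)))
        refine neg_le_of_abs_le ?_
        rw [abs_mul, abs_mul, mul_comm ‖_‖, ← mul_assoc]
        exact mul_le_mul_of_nonneg_left h5 (by positivity)
    have h6 := Finset.sum_le_sum fun i (_ : i ∈ Finset.univ) =>
      Finset.sum_le_sum fun j (_ : j ∈ Finset.univ) => h4 i j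
    refine le_trans ?_ h6
    simp_rw [Finset.sum_sub_distrib]
    have h7 : ∑ i, ∑ j, |y i| * (Q i j * |y j|) ≤ m / 2 * l2 y ^ 2 := by
      have h8 : ∑ i, ∑ j, |y i| * (Q i j * |y j|) = (fun i => |y i|) ⬝ᵥ Q *ᵥ fun i => |y i| := by
        simp only [dotProduct, Matrix.mulVec, Finset.mul_sum]
      have h9 : l2 (fun i => |y i|) = l2 y :=
        le_antisymm (l2_mono fun i => by simp) (l2_mono fun i => by simp)
      rw [h8]
      refine (dotProduct_le_l2 _ _).trans ?_
      have h10 := hQ fun i => |y i|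
      rw [h9] at h10 ⊢
      have h11 := h10.trans (mul_le_mul_of_nonneg_right hMT (l2_nonneg y))
      nlinarith [mul_le_mul_of_nonneg_left h11 (l2_nonneg y)]
    have h12 : ∑ i, ∑ j, (if i = j then m * y i ^ 2 else 0) = m * l2 y ^ 2 := by
      simp [l2_sq, Finset.mul_sum]
    rw [h12]
    linarith
  rw [hform, mul_assoc]
  exact (mul_le_mul_of_nonneg_left hbump hδ0.le).trans hmono

end Fourier

/-! ### Regularity of the covariance function and its parameter derivatives. -/

/-- The matrix of a stationary kernel at the points `z_i + ε x_i`. -/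
noncomputable def pointMatrix {d : ℕ} {ι : Type*} (k : E d → ℝ) (ε : ℝ) (z : ι → Fin d → ℤ)
    (x : ι → E d) : Matrix ι ι ℝ :=
  Matrix.of fun i j => k ((latticePoint (z i) + ε • x i) - (latticePoint (z j) + ε • x j))

/-- The properties of the covariance function `k` and of its derivatives `g i` in the parameters
on which the asymptotic analysis relies. -/
structure RegularModel {d p : ℕ} (ε : ℝ) (k : E d → ℝ) (g : Fin p → E d → ℝ) : Prop where
  continuous_cov : Continuous k
  continuous_deriv : ∀ i, Continuous (g i)
  even_cov : ∀ t, k (-t) = k t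
  even_deriv : ∀ i t, g i (-t) = g i t
  cov_zero : k 0 = 1
  deriv_zero : ∀ i, g i 0 = 0
  decay_cov : ∃ C : ℝ, ∀ t, |k t| ≤ C / (1 + ‖t‖ ^ (d + 1))
  decay_deriv : ∀ i, ∃ C : ℝ, ∀ t, |g i t| ≤ C / (1 + ‖t‖ ^ (d + 1))
  coercive : ∃ c > 0, ∀ {ι : Type} [Fintype ι] (z : ι → Fin d → ℤ) (x : ι → E d),
    Function.Injective z → (∀ i, InCube (x i)) → Coercive c (pointMatrix k ε z x)

namespace ModelCondition

variable {d p : ℕ} {θinf θsup : ℝ} {K : (Fin p → ℝ) → E d → ℝ}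

/-- Symmetry of the covariance matrix of the two points `t` and `0`. -/
lemma even (hK : ModelCondition d p θinf θsup K) {θ : Fin p → ℝ} (hθ : θ ∈ paramBox p θinf θsup)
    (t : E d) : K θ (-t) = K θ t := by
  have h := (hK.stationary θ hθ 2 ![t, 0]).isHermitian.apply 0 1
  simpa using h

lemma ofReal_re_hat (hK : ModelCondition d p θinf θsup K) {θ : Fin p → ℝ}
    (hθ : θ ∈ paramBox p θinf θsup) (f : E d) :
    (((fourierHat (K θ) f).re : ℝ) : ℂ) = fourierHat (K θ) f :=
  Complex.ext (by simp) (by simp [(hK.positive_hat θ hθ f).1])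

/-- Fourier inversion with an integrable spectral density, and dominated convergence. -/
lemma continuous_cov (hK : ModelCondition d p θinf θsup K) {θ : Fin p → ℝ}
    (hθ : θ ∈ paramBox p θinf θsup) : Continuous (K θ) := by
  have h : Continuous fun t => ∫ f, fourierHat (K θ) f * character f t := by
    refine continuous_of_dominated (bound := fun f => ‖fourierHat (K θ) f‖) (fun t => ?_)
      (fun t => ae_of_all _ fun f => ?_) (hK.integrable_hat θ hθ).norm (ae_of_all _ fun f => ?_)
    · exact (hK.integrable_hat θ hθ).aestronglyMeasurable.mul
        (continuous_character t).aestronglyMeasurable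
    · rw [norm_mul, norm_character, mul_one]
    · exact continuous_const.mul (continuous_character_right f)
  refine (Complex.continuous_re.comp h).congr fun t => ?_
  have := congrArg Complex.re (hK.inversion θ hθ t)
  rw [Complex.ofReal_re] at this
  exact this.symm

section Derivative

variable {θ : Fin p → ℝ} (hθ : ∀ i, θinf < θ i ∧ θ i < θsup)
include hθ

lemma mem_paramBox : θ ∈ paramBox p θinf θsup := fun i => ⟨(hθ i).1.le, (hθ i).2.le⟩

lemma update_mem_paramBox (i : Fin p) {s : ℝ} (hs : s ∈ Set.Icc θinf θsup) :
    Function.update θ i s ∈ paramBox p θinf θsup := by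
  intro j
  by_cases hj : j = i
  · subst hj; simpa using hs
  · rw [Function.update_of_ne hj]; exact mem_paramBox hθ j

/-- The difference quotients in a parameter converge uniformly in `t`. -/
lemma exists_difference_quotient_le (hK : ModelCondition d p θinf θsup K) (i : Fin p) :
    ∃ C : ℝ, 0 ≤ C ∧ ∀ η > 0, θ i + η ≤ θsup → ∀ t,
      |partialDeriv θinf θsup i (fun ϑ => K ϑ t) θ
        - (K (Function.update θ i (θ i + η)) t - K θ t) / η| ≤ C * η := by
  obtain ⟨C, hC⟩ := hK.decay [i, i] (by simp)
  have hC0 : 0 ≤ C := by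
    have := (abs_nonneg _).trans (hC θ (mem_paramBox hθ) 0)
    simpa using this
  refine ⟨C, hC0, fun η hη hηs t => ?_⟩
  set I := Set.Icc θinf θsup with hI
  set f : ℝ → ℝ := fun s => K (Function.update θ i s) t with hf
  set D : ℝ → ℝ := fun s => partialDeriv θinf θsup i (fun ϑ => K ϑ t) (Function.update θ i s)
    with hD
  have hD0 : D (θ i) = partialDeriv θinf θsup i (fun ϑ => K ϑ t) θ := by
    simp [hD]
  have hθI : θ i ∈ I := ⟨(hθ i).1.le, (hθ i).2.le⟩
  have hfD : ∀ s ∈ I, HasDerivWithinAt f (D s) I s := by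
    intro s hs
    have h1 := hK.differentiable [] (by simp) i _ (update_mem_paramBox hθ i hs) t
    simp only [HasPartialAt, iterPartial, List.foldr_nil, Function.update_idem,
      Function.update_self] at h1
    have h2 : D s = derivWithin f I s := by
      simp only [hD, partialDeriv, Function.update_idem, Function.update_self, hf, hI]
    rw [h2]
    exact h1.hasDerivWithinAt
  -- The second partial derivative is bounded uniformly in `t`, so the first is Lipschitz along the
  -- segment with the same constant for all `t`.
  have hDlip : ∀ s ∈ I, |D s - D (θ i)| ≤ C * |s - θ i| := by
    intro s hs
    refine Convex.norm_image_sub_le_of_norm_derivWithin_le (f := D) (s := I) (fun s hs => ?_) (fun s hs => ?_)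
      (convex_Icc θinf θsup) hθI hs
    · have h1 := hK.differentiable [i] (by simp) i _ (update_mem_paramBox hθ i hs) t
      simp only [HasPartialAt, iterPartial, List.foldr_nil, List.foldr_cons, Function.update_idem,
        Function.update_self] at h1
      exact h1
    · have h1 := hC _ (update_mem_paramBox hθ i hs) t
      have h2 : iterPartial θinf θsup [i, i] (fun ϑ => K ϑ t) (Function.update θ i s)
          = derivWithin D I s := by
        simp only [iterPartial, List.foldr_cons, List.foldr_nil]
        rw [partialDeriv]
        simp only [Function.update_idem, Function.update_self, hD, hI]
      rw [h2] at h1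
      exact h1.trans (div_le_self hC0 (le_add_of_nonneg_right (by positivity)))
  have hsub : Set.Icc (θ i) (θ i + η) ⊆ I := Set.Icc_subset_Icc hθI.1 hηs
  -- Mean value inequality for `f s - s D(θ i)`, whose derivative is at most `C η` in absolute
  -- value.
  have hmv : |(f (θ i + η) - (θ i + η) * D (θ i)) - (f (θ i) - θ i * D (θ i))|
      ≤ C * η * |θ i + η - θ i| := by
    refine Convex.norm_image_sub_le_of_norm_hasDerivWithin_le (s := Set.Icc (θ i) (θ i + η))
      (f := fun s => f s - s * D (θ i)) (f' := fun s => D s - 1 * D (θ i)) (fun s hs => ?_)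
      (fun s hs => ?_) (convex_Icc _ _) (Set.left_mem_Icc.2 (by linarith))
      (Set.right_mem_Icc.2 (by linarith))
    · exact ((hfD s (hsub hs)).mono hsub).sub ((hasDerivWithinAt_id s _).mul_const _)
    · rw [one_mul]
      refine (hDlip s (hsub hs)).trans (mul_le_mul_of_nonneg_left ?_ hC0)
      rw [abs_of_nonneg (by linarith [hs.1])]
      linarith [hs.2]
  rw [add_sub_cancel_left, abs_of_pos hη] at hmv
  have hf0 : f (θ i) = K θ t := by simp [hf]
  rw [← hD0, ← hf0]
  have h3 : D (θ i) - (f (θ i + η) - f (θ i)) / η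
      = -((f (θ i + η) - (θ i + η) * D (θ i)) - (f (θ i) - θ i * D (θ i))) / η := by
    field_simp
    ring
  rw [h3, abs_div, abs_neg, abs_of_pos hη, div_le_iff₀ hη]
  exact hmv

/-- A uniform limit of difference quotients, each continuous in `t`. -/
lemma continuous_partialDeriv (hK : ModelCondition d p θinf θsup K) (i : Fin p) :
    Continuous fun t => partialDeriv θinf θsup i (fun ϑ => K ϑ t) θ := by
  obtain ⟨C, hC, h⟩ := exists_difference_quotient_le hθ hK i
  refine continuous_of_uniform_approx_of_continuous fun u hu => ?_
  obtain ⟨ρ, hρ, hρu⟩ := Metric.mem_uniformity_dist.1 hu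
  set η := min (θsup - θ i) (ρ / (2 * (C + 1))) with hη
  have hη0 : 0 < η := lt_min (by linarith [(hθ i).2]) (by positivity)
  have hηs : θ i + η ≤ θsup := by linarith [min_le_left (θsup - θ i) (ρ / (2 * (C + 1)))]
  refine ⟨fun t => (K (Function.update θ i (θ i + η)) t - K θ t) / η, ?_, fun t => hρu ?_⟩
  · exact ((hK.continuous_cov (update_mem_paramBox hθ i
      ⟨by linarith [(hθ i).1], hηs⟩)).sub (hK.continuous_cov (mem_paramBox hθ))).div_const η
  · rw [Real.dist_eq]
    refine (h η hη0 hηs t).trans_lt ?_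
    have h1 : η ≤ ρ / (2 * (C + 1)) := min_le_right _ _
    rw [le_div_iff₀ (by positivity)] at h1
    nlinarith

lemma even_partialDeriv (hK : ModelCondition d p θinf θsup K) (i : Fin p) (t : E d) :
    partialDeriv θinf θsup i (fun ϑ => K ϑ (-t)) θ
      = partialDeriv θinf θsup i (fun ϑ => K ϑ t) θ := by
  have h : ∀ s ∈ Set.Icc θinf θsup, K (Function.update θ i s) (-t) = K (Function.update θ i s) t :=
    fun s hs => hK.even (update_mem_paramBox hθ i hs) t
  exact derivWithin_congr h (h _ (mem_paramBox hθ i))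

lemma partialDeriv_zero (hcorr : ∀ ϑ ∈ paramBox p θinf θsup, K ϑ 0 = 1) (i : Fin p) :
    partialDeriv θinf θsup i (fun ϑ => K ϑ 0) θ = 0 := by
  have h : ∀ s ∈ Set.Icc θinf θsup, K (Function.update θ i s) 0 = 1 :=
    fun s hs => hcorr _ (update_mem_paramBox hθ i hs)
  rw [partialDeriv, derivWithin_congr (f := fun _ => (1 : ℝ)) h (h _ (mem_paramBox hθ i))]
  simp

lemma regularModel (hK : ModelCondition d p θinf θsup K)
    (hcorr : ∀ ϑ ∈ paramBox p θinf θsup, K ϑ 0 = 1) {ε : ℝ} (hε : 0 ≤ ε) (hε' : ε < 1 / 2) :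
    RegularModel ε (K θ) fun i t => partialDeriv θinf θsup i (fun ϑ => K ϑ t) θ where
  continuous_cov := hK.continuous_cov (mem_paramBox hθ)
  continuous_deriv := continuous_partialDeriv hθ hK
  even_cov := hK.even (mem_paramBox hθ)
  even_deriv := even_partialDeriv hθ hK
  cov_zero := hcorr _ (mem_paramBox hθ)
  deriv_zero := partialDeriv_zero hθ hcorr
  decay_cov := by
    obtain ⟨C, hC⟩ := hK.decay [] (by simp)
    exact ⟨C, fun t => hC θ (mem_paramBox hθ) t⟩
  decay_deriv i := by
    obtain ⟨C, hC⟩ := hK.decay [i] (by simp)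
    exact ⟨C, fun t => hC θ (mem_paramBox hθ) t⟩
  coercive := by
    have hmem := mem_paramBox hθ
    refine exists_coercive (k := K θ) (h := fun f => (fourierHat (K θ) f).re) ?_
      (fun f => (hK.positive_hat θ hmem f).2) (hK.integrable_hat θ hmem).re (fun t => ?_) hε hε'
    · refine Complex.continuous_re.comp ?_
      rw [← continuousOn_univ]
      exact hK.continuous_hat.comp (f := fun f : E d => (f, θ)) (by fun_prop)
        fun f _ => ⟨Set.mem_univ _, hmem⟩
    · rw [hK.inversion θ hmem t]
      simp_rw [hK.ofReal_re_hat hmem]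
      rfl

end Derivative

end ModelCondition

/-! ### Uniform bounds for the matrices of the model, and locality of the Hessian entries. -/

section PointMatrix

variable {d p : ℕ} {ε : ℝ} {k : E d → ℝ} {g : Fin p → E d → ℝ}

lemma pointMatrix_apply {ι : Type*} (k : E d → ℝ) (ε : ℝ) (z : ι → Fin d → ℤ)
    (x : ι → E d) (i j : ι) :
    pointMatrix k ε z x i j = k (latticePoint (z i - z j) + ε • (x i - x j)) := by
  rw [pointMatrix, Matrix.of_apply]
  congr 1
  ext a
  simp [latticePoint]
  ring

lemma pointMatrix_transpose {ι : Type*} (hk : ∀ t, k (-t) = k t) (z : ι → Fin d → ℤ)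
    (x : ι → E d) : (pointMatrix k ε z x)ᵀ = pointMatrix k ε z x := by
  ext i j
  rw [Matrix.transpose_apply, pointMatrix, Matrix.of_apply, Matrix.of_apply, ← hk, neg_sub]

lemma pointMatrix_diag {ι : Type*} (k : E d → ℝ) (z : ι → Fin d → ℤ) (x : ι → E d) (i : ι) :
    pointMatrix k ε z x i i = k 0 := by
  simp [pointMatrix]

lemma sum_smul_pointMatrix {ι κ : Type*} [Fintype κ] (g : κ → E d → ℝ) (lam : κ → ℝ)
    (z : ι → Fin d → ℤ) (x : ι → E d) :
    ∑ i, lam i • pointMatrix (g i) ε z x = pointMatrix (fun t => ∑ i, lam i * g i t) ε z x := by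
  ext a b
  simp [pointMatrix, Matrix.sum_apply]

lemma OpBound.mono {ι : Type*} [Fintype ι] {Q : Matrix ι ι ℝ} {C C' : ℝ} (h : OpBound C Q)
    (hC : C ≤ C') : OpBound C' Q := fun y =>
  (h y).trans (mul_le_mul_of_nonneg_right hC (l2_nonneg y))

/-- The constant `A` bounds the operator norms of the matrices of `k` and `g i`, and their
commutators with cutoffs. -/
structure UniformBounds (ε : ℝ) (k : E d → ℝ) (g : Fin p → E d → ℝ) (c A : ℝ) : Prop where
  pos : 0 < c
  bound_pos : 0 < A
  coercive : ∀ {ι : Type} [Fintype ι] (z : ι → Fin d → ℤ) (x : ι → E d),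
    Function.Injective z → (∀ i, InCube (x i)) → Coercive c (pointMatrix k ε z x)
  opBound : ∀ {ι : Type} [Fintype ι] (z : ι → Fin d → ℤ) (x : ι → E d),
    Function.Injective z → (∀ i, InCube (x i)) →
      OpBound A (pointMatrix k ε z x) ∧ ∀ i, OpBound A (pointMatrix (g i) ε z x)
  commBound : ∀ {ι : Type} [Fintype ι] (z : ι → Fin d → ℤ) (x : ι → E d),
    Function.Injective z → (∀ i, InCube (x i)) → ∀ (a : Fin d → ℤ) (s : ℝ), 0 < s →
      CommBound (fun m => cutoff s (z m - a)) (A * cutoffSum d ε s) (pointMatrix k ε z x) ∧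
      ∀ i, CommBound (fun m => cutoff s (z m - a)) (A * cutoffSum d ε s) (pointMatrix (g i) ε z x)

lemma RegularModel.exists_decay (hM : RegularModel ε k g) : ∃ C > 0,
    (∀ t, |k t| ≤ C / (1 + ‖t‖ ^ (d + 1))) ∧ ∀ i t, |g i t| ≤ C / (1 + ‖t‖ ^ (d + 1)) := by
  obtain ⟨C₀, h₀⟩ := hM.decay_cov
  choose C h using hM.decay_deriv
  refine ⟨1 + |C₀| + ∑ i, |C i|, by positivity, fun t => ?_, fun i t => ?_⟩
  · refine (h₀ t).trans ?_
    gcongr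
    have := Finset.sum_nonneg fun i (_ : i ∈ Finset.univ) => abs_nonneg (C i)
    linarith [le_abs_self C₀]
  · refine (h i t).trans ?_
    gcongr
    have := Finset.single_le_sum (f := fun i => |C i|) (fun i _ => abs_nonneg (C i))
      (Finset.mem_univ i)
    linarith [le_abs_self (C i), abs_nonneg C₀]

lemma cutoffSum_nonneg (hε' : ε < 1 / 2) {s : ℝ} (hs : 0 < s) : 0 ≤ cutoffSum d ε s :=
  tsum_nonneg fun u => mul_nonneg (cutoff_nonneg hs u) (latticeKernel_nonneg hε' u)

lemma RegularModel.exists_uniformBounds (hM : RegularModel ε k g) (hε : 0 ≤ ε)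
    (hε' : ε < 1 / 2) : ∃ c A, UniformBounds ε k g c A := by
  obtain ⟨C, hC, hk, hg⟩ := hM.exists_decay
  obtain ⟨c, hc, hcoer⟩ := hM.coercive
  set T := ∑' u : Fin d → ℤ, C * latticeKernel d ε u with hT
  have hT0 : 0 ≤ T := tsum_nonneg fun u => mul_nonneg hC.le (latticeKernel_nonneg hε' u)
  have hle : ∀ {f : E d → ℝ}, (∀ t, |f t| ≤ C / (1 + ‖t‖ ^ (d + 1))) →
      ∀ {ι : Type} [Fintype ι] (z : ι → Fin d → ℤ) (x : ι → E d), (∀ i, InCube (x i)) →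
      ∀ i j, |pointMatrix f ε z x i j| ≤ C * latticeKernel d ε (z i - z j) := by
    intro f hf ι _ z x hx i j
    rw [pointMatrix_apply]
    exact abs_le_latticeKernel hε hε' hf _ (hx i) (hx j)
  have hop : ∀ {f : E d → ℝ}, (∀ t, |f t| ≤ C / (1 + ‖t‖ ^ (d + 1))) →
      ∀ {ι : Type} [Fintype ι] (z : ι → Fin d → ℤ) (x : ι → E d), Function.Injective z →
      (∀ i, InCube (x i)) → OpBound (C + T) (pointMatrix f ε z x) := by
    intro f hf ι _ z x hz hx
    refine (opBound_of_kernel hz (fun u => mul_nonneg hC.le (latticeKernel_nonneg hε' u))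
      ((summable_latticeKernel d ε).mul_left C) (hle hf z x hx)).mono ?_
    linarith
  have hcomm : ∀ {f : E d → ℝ}, (∀ t, |f t| ≤ C / (1 + ‖t‖ ^ (d + 1))) →
      ∀ {ι : Type} [Fintype ι] (z : ι → Fin d → ℤ) (x : ι → E d), Function.Injective z →
      (∀ i, InCube (x i)) → ∀ (a : Fin d → ℤ) (s : ℝ), 0 < s →
      CommBound (fun m => cutoff s (z m - a)) ((C + T) * cutoffSum d ε s)
        (pointMatrix f ε z x) := by
    intro f hf ι _ z x hz hx a s hs y
    refine (commBound_of_kernel hz hε' hs hC.le (hle hf z x hx) a y).trans ?_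
    refine mul_le_mul_of_nonneg_right ?_ (l2_nonneg y)
    exact mul_le_mul_of_nonneg_right (by linarith) (cutoffSum_nonneg hε' hs)
  -- `T` bounds the operator norms and `C` the commutators; the sum serves both and is positive.
  exact ⟨c, C + T, hc, by linarith, hcoer,
    fun z x hz hx => ⟨hop hk z x hz hx, fun i => hop (hg i) z x hz hx⟩,
    fun z x hz hx a s hs => ⟨hcomm hk z x hz hx a s hs, fun i => hcomm (hg i) z x hz hx a s hs⟩⟩

/-- The centre of the box. -/
def windowZero (d r : ℕ) : Window d r :=
  ⟨0, Finset.mem_Icc.2 ⟨fun _ => by simp, fun _ => by simp⟩⟩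

/-- The diagonal entry of `M_{CV,2}` at the centre of the box of radius `r`. -/
noncomputable def windowHess (ε : ℝ) (k : E d → ℝ) (g : Fin p → E d → ℝ) (r : ℕ) (i j : Fin p)
    (y : Window d r → E d) : ℝ :=
  hessTerm (pointMatrix k ε Subtype.val y) (pointMatrix (g i) ε Subtype.val y)
    (pointMatrix (g j) ε Subtype.val y) (windowZero d r)

/-- The diagonal entry of `M_{CV,2}` with index `l` for the first `n` observation points. -/
noncomputable def gridHess (ε : ℝ) (k : E d → ℝ) (g : Fin p → E d → ℝ) (v : ℕ → Fin d → ℕ)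
    (x : ℕ → E d) (n : ℕ) (i j : Fin p) (l : Fin n) : ℝ :=
  hessTerm (pointMatrix k ε (fun m : Fin n => site v m) fun m => x m)
    (pointMatrix (g i) ε (fun m : Fin n => site v m) fun m => x m)
    (pointMatrix (g j) ε (fun m : Fin n => site v m) fun m => x m) l

lemma site_fin_injective {v : ℕ → Fin d → ℕ} (hv : Function.Injective v) (n : ℕ) :
    Function.Injective fun m : Fin n => site v m :=
  (site_injective hv).comp Fin.val_injective

lemma exists_window (u : Fin d → ℤ) : ∃ r : ℕ, u ∈
    Finset.Icc (fun _ : Fin d => -(r : ℤ)) (fun _ => (r : ℤ)) := by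
  refine ⟨∑ i, (u i).natAbs, Finset.mem_Icc.2 ⟨fun i => ?_, fun i => ?_⟩⟩ <;>
  · have := Finset.single_le_sum (f := fun i => (u i).natAbs) (fun i _ => Nat.zero_le _)
      (Finset.mem_univ i)
    simp only at this ⊢
    omega

lemma one_le_cutoff_of_notMem {r : ℕ} (hr : 1 ≤ r) {u : Fin d → ℤ}
    (hu : u ∉ Finset.Icc (fun _ : Fin d => -(r : ℤ)) (fun _ => (r : ℤ))) :
    1 ≤ cutoff (r : ℝ) u := by
  have hr' : (0 : ℝ) < r := by exact_mod_cast hr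
  refine le_min le_rfl ((one_le_div hr').2 ?_)
  by_contra! hlt
  refine hu (Finset.mem_Icc.2 ⟨fun i => ?_, fun i => ?_⟩) <;>
  · have h1 := (norm_le_pi_norm u i).trans hlt.le
    rw [Int.norm_eq_abs] at h1
    have h2 : |u i| ≤ (r : ℤ) := by exact_mod_cast h1
    have h3 := abs_le.1 h2
    simp only
    omega

/-- The diagonal entries of `M_{CV,2}` are determined locally, up to a small error. -/
theorem UniformBounds.exists_local {c A : ℝ} (hU : UniformBounds ε k g c A)
    (hε' : ε < 1 / 2) {η : ℝ} (hη : 0 < η) :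
    ∃ r : ℕ, ∀ (i j : Fin p) {v : ℕ → Fin d → ℕ} (_ : Function.Injective v) (x : ℕ → E d)
      (_ : ∀ m, InCube (x m)) (n : ℕ) (l : Fin n), Interior v r n l →
      |windowHess ε k g r i j (patch v r x l) - gridHess ε k g v x n i j l| ≤ η := by
  obtain ⟨δ₀, hδ₀, hloc⟩ := hessTerm_local hU.pos hU.bound_pos hη
  have hlim := (tendsto_cutoffSum (d := d) hε').const_mul A
  rw [mul_zero] at hlim
  -- The same `r` is the scale of the cutoff and the radius of the window: the cutoff is zero at the
  -- centre and `1` outside the window.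
  obtain ⟨r, hr1, hr⟩ := ((eventually_ge_atTop 1).and (hlim.eventually (gt_mem_nhds hδ₀))).exists
  refine ⟨r, fun i j v hv x hx n l hl => ?_⟩
  have hr' : (0 : ℝ) < r := by exact_mod_cast hr1
  have hidx : ∀ u : Window d r, idx v l u < n ∧ site v (idx v l u) = site v l + u := by
    intro u
    obtain ⟨m, hm, hmv⟩ := hl u
    rw [idx_eq hv hmv]
    exact ⟨hm, hmv⟩
  let e : Window d r → Fin n := fun u => ⟨idx v l u, (hidx u).1⟩
  have he : Function.Injective e := fun u w h =>
    idx_injective (fun u => ⟨_, (hidx u).2⟩) (congrArg Fin.val h)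
  -- The entries depend only on differences of sites, so the window around `v_l` may be recentred at
  -- the origin.
  have hsub : ∀ f : E d → ℝ,
      (pointMatrix f ε (fun m : Fin n => site v m) fun m => x m).submatrix e e
        = pointMatrix f ε Subtype.val (patch v r x l) := by
    intro f
    ext u w
    rw [Matrix.submatrix_apply, pointMatrix_apply, pointMatrix_apply]
    simp only [e, (hidx u).2, (hidx w).2, patch, add_sub_add_left_eq_sub]
  have he0 : e (windowZero d r) = l := by
    refine Fin.ext (idx_eq hv ?_)
    simp [windowZero]
  have hz := site_fin_injective hv n
  have hx' : ∀ m : Fin n, InCube (x m) := fun m => hx m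
  have hw : Function.Injective (Subtype.val : Window d r → Fin d → ℤ) := Subtype.val_injective
  have hxp : ∀ u, InCube (patch v r x l u) := fun u => hx _
  have h1 := hU.opBound _ _ hz hx'
  have h2 := hU.opBound _ _ hw hxp
  have h3 := hU.commBound _ _ hz hx' (site v l) r hr'
  have key := hloc e (fun m => cutoff (r : ℝ) (site v m - site v l)) _ _ _ _ (windowZero d r)
    he ?_ ?_ ?_ hr.le h1.1 (h1.2 i) (h1.2 j) (hU.coercive _ _ hz hx')
    (by rw [hsub]; exact h2.1) (by rw [hsub]; exact h2.2 i) (by rw [hsub]; exact h2.2 j)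
    (by rw [hsub]; exact hU.coercive _ _ hw hxp) h3.1 (h3.2 i) (h3.2 j)
  · rwa [hsub, hsub, hsub, he0] at key
  · intro m hm
    refine one_le_cutoff_of_notMem hr1 fun hmem => hm ⟨⟨_, hmem⟩, Fin.ext (idx_eq hv ?_)⟩
    rw [add_sub_cancel]
  · rw [he0]; simp [cutoff]
  · exact mul_nonneg hU.bound_pos.le (cutoffSum_nonneg hε' hr')

lemma UniformBounds.exists_hess_le {c A : ℝ} (hU : UniformBounds ε k g c A) :
    ∃ B > 0, (∀ r i j (y : Window d r → E d), (∀ u, InCube (y u)) →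
      |windowHess ε k g r i j y| ≤ B) ∧
      ∀ {v : ℕ → Fin d → ℕ} (_ : Function.Injective v) (x : ℕ → E d) (_ : ∀ m, InCube (x m))
        n i j l, |gridHess ε k g v x n i j l| ≤ B := by
  obtain ⟨B, hB, h⟩ := hessTerm_bounded hU.pos hU.bound_pos
  refine ⟨B, hB, fun r i j y hy => ?_, fun hv x hx n i j l => ?_⟩
  · have h1 := hU.opBound _ y Subtype.val_injective hy
    exact h h1.1 (h1.2 i) (h1.2 j) (hU.coercive _ _ Subtype.val_injective hy) _
  · have hz := site_fin_injective hv n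
    have hx' : ∀ m : Fin n, InCube (x m) := fun m => hx m
    have h1 := hU.opBound _ _ hz hx'
    exact h h1.1 (h1.2 i) (h1.2 j) (hU.coercive _ _ hz hx') _

section Measurability

variable {S ι : Type*} [MeasurableSpace S] [Fintype ι]

lemma measurable_mul_apply {A B : S → Matrix ι ι ℝ} (hA : ∀ i j, Measurable fun s => A s i j)
    (hB : ∀ i j, Measurable fun s => B s i j) (i j : ι) : Measurable fun s => (A s * B s) i j := by
  simp only [Matrix.mul_apply]
  exact Finset.measurable_sum _ fun m _ => (hA i m).mul (hB m j)

/-- The inverse is the adjugate divided by the determinant, which is measurable even where the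
matrix is singular. -/
lemma measurable_windowHess (hM : RegularModel ε k g) (r : ℕ) (i j : Fin p) :
    Measurable (windowHess ε k g r i j) := by
  have hcont : ∀ {f : E d → ℝ}, Continuous f →
      Continuous fun y : Window d r → E d => pointMatrix f ε Subtype.val y := by
    intro f hf
    refine continuous_matrix fun a b => ?_
    simp only [pointMatrix, Matrix.of_apply]
    fun_prop
  have hk := hcont hM.continuous_cov
  have hg : ∀ i a b, Measurable fun y : Window d r → E d =>
      pointMatrix (g i) ε Subtype.val y a b := fun i a b =>
    ((hcont (hM.continuous_deriv i)).matrix_elem a b).measurable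
  have hinv : ∀ a b, Measurable fun y : Window d r → E d =>
      (pointMatrix k ε Subtype.val y)⁻¹ a b := by
    intro a b
    simp only [Matrix.inv_def, Ring.inverse_eq_inv', Matrix.smul_apply, smul_eq_mul]
    exact hk.matrix_det.measurable.inv.mul (hk.matrix_adjugate.matrix_elem a b).measurable
  have hb : ∀ i a b, Measurable fun y : Window d r → E d =>
      ((pointMatrix k ε Subtype.val y)⁻¹ * pointMatrix (g i) ε Subtype.val y
        * (pointMatrix k ε Subtype.val y)⁻¹) a b := fun i =>
    measurable_mul_apply (measurable_mul_apply hinv (hg i)) hinv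
  have hc := measurable_mul_apply (measurable_mul_apply (hb i) (hg j)) hinv
  unfold windowHess hessTerm hessFun
  exact (((hc _ _).const_mul 2).div ((hinv _ _).pow_const 2)).sub
    ((((hb i _ _).const_mul 2).mul (hb j _ _)).div ((hinv _ _).pow_const 3))

lemma measurableSet_inCube : MeasurableSet {x : E d | InCube x} := by
  simp only [InCube, Set.ofPred_forall]
  exact MeasurableSet.iInter fun a => measurableSet_le (by fun_prop) measurable_const

lemma measurableSet_forall_inCube (r : ℕ) :
    MeasurableSet {y : Window d r → E d | ∀ u, InCube (y u)} := by
  rw [Set.ofPred_forall]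
  exact MeasurableSet.iInter fun u => measurableSet_inCube.preimage (measurable_pi_apply u)

end Measurability

end PointMatrix

/-! ### Deterministic almost sure limits from approximate ones. -/

section Limit

variable {Ω : Type*} [MeasurableSpace Ω] {P : Measure Ω} [IsProbabilityMeasure P]

/-- The constants `m` are deterministic: one good `ω₀` gives a Cauchy sequence whose limit is within
`1/(q+1)` of `m q`, and this forces the same limit for almost every `ω`. -/
lemma exists_ae_tendsto {T : ℕ → Ω → ℝ}
    (h : ∀ η > 0, ∃ m : ℝ, ∀ᵐ ω ∂P, ∀ᶠ n in atTop, |T n ω - m| ≤ η) :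
    ∃ S : ℝ, ∀ᵐ ω ∂P, Tendsto (fun n => T n ω) atTop (𝓝 S) := by
  choose m hm using fun q : ℕ => h (1 / ((q : ℝ) + 1)) (by positivity)
  have hall := ae_all_iff.2 hm
  obtain ⟨ω₀, h₀⟩ := hall.exists
  have hcau : CauchySeq fun n => T n ω₀ := by
    refine Metric.cauchySeq_iff'.2 fun δ hδ => ?_
    obtain ⟨q, hq⟩ := exists_nat_one_div_lt (half_pos hδ)
    obtain ⟨N, hN⟩ := eventually_atTop.1 (h₀ q)
    refine ⟨N, fun n hn => ?_⟩
    have h1 := abs_le.1 (hN n hn)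
    have h2 := abs_le.1 (hN N le_rfl)
    rw [Real.dist_eq, abs_lt]
    constructor <;> linarith
  obtain ⟨S, hS⟩ := cauchySeq_tendsto_of_complete hcau
  have hSm : ∀ q, |S - m q| ≤ 1 / ((q : ℝ) + 1) := fun q =>
    le_of_tendsto (hS.sub_const (m q)).abs (h₀ q)
  refine ⟨S, hall.mono fun ω hω => Metric.tendsto_atTop'.2 fun δ hδ => ?_⟩
  obtain ⟨q, hq⟩ := exists_nat_one_div_lt (half_pos hδ)
  obtain ⟨N, hN⟩ := eventually_atTop.1 (hω q)
  refine ⟨N, fun n hn => ?_⟩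
  have h1 := abs_le.1 (hN n hn.le)
  have h2 := abs_le.1 (hSm q)
  rw [Real.dist_eq, abs_lt]
  constructor <;> linarith

end Limit

/-! ### Almost sure convergence of the averages and positivity of the limiting form. -/

section Asymptotics

variable {d p : ℕ} {ε : ℝ} {k : E d → ℝ} {g : Fin p → E d → ℝ} {L : Measure (E d)}
  {v : ℕ → Fin d → ℕ}

lemma PerturbationLaw.ae_inCube (hL : PerturbationLaw L) : ∀ᵐ x ∂L, InCube x := by
  have h : ∀ᵐ x ∂L, x ∈ L.support := Measure.support_mem_ae
  exact h.mono fun x hx => hL.support_subset hx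

variable {Ω : Type*} [MeasurableSpace Ω] {P : Measure Ω} {X : ℕ → Ω → E d}

lemma PerturbationLaw.ae_forall_inCube (hL : PerturbationLaw L) (hXm : ∀ i, Measurable (X i))
    (hXlaw : ∀ i, P.map (X i) = L) : ∀ᵐ ω ∂P, ∀ m, InCube (X m ω) := by
  refine ae_all_iff.2 fun m => ae_of_ae_map (hXm m).aemeasurable ?_
  rw [hXlaw]
  exact hL.ae_inCube

variable [IsProbabilityMeasure P]

open Classical in
/-- The averages of the diagonal entries of `M_{CV,2}` converge almost surely. -/
theorem UniformBounds.exists_ae_tendsto_gridHess {c A : ℝ} (hU : UniformBounds ε k g c A)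
    (hM : RegularModel ε k g) (hε' : ε < 1 / 2) (hd : 1 ≤ d) (hv : IsGridEnumeration v)
    (hL : PerturbationLaw L) (hXm : ∀ i, Measurable (X i)) (hXind : iIndepFun X P)
    (hXlaw : ∀ i, P.map (X i) = L) (i j : Fin p) :
    ∃ S : ℝ, ∀ᵐ ω ∂P, Tendsto (fun n : ℕ => 1 / (n : ℝ) *
      ∑ l, gridHess ε k g v (fun m => X m ω) n i j l) atTop (𝓝 S) := by
  have := hL.isProbability
  have hinj := hv.injective hd
  obtain ⟨B, hB, hwB, hgB⟩ := hU.exists_hess_le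
  refine exists_ae_tendsto fun η hη => ?_
  obtain ⟨r, hr⟩ := hU.exists_local hε' (by positivity : 0 < η / 4)
  -- The entry is controlled only for perturbations in the cube, whereas the law of large numbers
  -- asks for a bound everywhere.
  let H : (Window d r → E d) → ℝ := {y | ∀ u, InCube (y u)}.indicator (windowHess ε k g r i j)
  have hHm : Measurable H :=
    (measurable_windowHess hM r i j).indicator (measurableSet_forall_inCube r)
  have hHB : ∀ y, |H y| ≤ B := by
    intro y
    by_cases hy : ∀ u, InCube (y u)
    · simpa only [H, Set.indicator_of_mem (show y ∈ {y | ∀ u, InCube (y u)} from hy)]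
        using hwB r i j y hy
    · simpa only [H, Set.indicator_of_notMem (show y ∉ {y | ∀ u, InCube (y u)} from hy), abs_zero]
        using hB.le
  refine ⟨∫ y, H y ∂Measure.pi fun _ => L, ?_⟩
  filter_upwards [ae_tendsto_localAverage hd hv hXm hXind hXlaw hHm hHB,
    hL.ae_forall_inCube hXm hXlaw] with ω hω hcube
  have hbad := (tendsto_not_interior hv hd r).const_mul B
  rw [mul_zero] at hbad
  have hη4 : 0 < η / 4 := by positivity
  filter_upwards [(Metric.tendsto_nhds.1 hω) _ hη4, hbad.eventually (gt_mem_nhds hη4)]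
    with n h1 h2
  rw [Real.dist_eq] at h1
  set x : ℕ → E d := fun m => X m ω with hx
  -- Interior indices contribute at most `η/4` on average by locality, and each remaining index at
  -- most `B`.
  have h3 : |1 / (n : ℝ) * ∑ l, gridHess ε k g v x n i j l - 1 / (n : ℝ) *
      ∑ l ∈ Finset.range n, if Interior v r n l then H (patch v r x l) else 0|
      ≤ η / 4 + B * (1 / (n : ℝ) *
        ((Finset.range n).filter fun i => ¬ Interior v r n i).card) := by
    rw [Finset.sum_range, ← mul_sub, ← Finset.sum_sub_distrib, abs_mul,
      abs_of_nonneg (by positivity : 0 ≤ 1 / (n : ℝ))]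
    have h4 : |∑ l : Fin n, (gridHess ε k g v x n i j l
        - if Interior v r n l then H (patch v r x l) else 0)|
        ≤ ∑ l : Fin n, (η / 4 + if ¬ Interior v r n l then B else 0) := by
      refine (Finset.abs_sum_le_sum_abs _ _).trans (Finset.sum_le_sum fun l _ => ?_)
      by_cases hl : Interior v r n l
      · have h5 : H (patch v r x l) = windowHess ε k g r i j (patch v r x l) :=
          Set.indicator_of_mem
            (show patch v r x l ∈ {y | ∀ u, InCube (y u)} from fun u => hcube _) _
        rw [if_pos hl, if_neg (not_not.2 hl), h5, abs_sub_comm, add_zero]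
        exact hr i j hinj x hcube n l hl
      · rw [if_neg hl, if_pos hl, sub_zero]
        exact (hgB hinj x hcube n i j l).trans (by linarith)
    rw [Finset.sum_add_distrib, Finset.sum_const, Finset.card_univ, Fintype.card_fin,
      nsmul_eq_mul, ← Finset.sum_range (fun l => if ¬ Interior v r n l then B else 0),
      ← Finset.sum_filter, Finset.sum_const, nsmul_eq_mul] at h4
    refine (mul_le_mul_of_nonneg_left h4 (by positivity)).trans ?_
    rw [mul_add, ← mul_assoc]
    have h6 : 1 / (n : ℝ) * n ≤ 1 := by
      rw [one_div_mul_eq_div]; exact div_self_le_one _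
    refine add_le_add ?_ (le_of_eq (by ring))
    nlinarith
  have h7 := abs_le.1 h3
  have h8 := abs_lt.1 h1
  rw [abs_le]
  constructor <;> linarith

lemma gridHess_comm (hM : RegularModel ε k g) (x : ℕ → E d) (n : ℕ) (i j : Fin p) (l : Fin n) :
    gridHess ε k g v x n i j l = gridHess ε k g v x n j i l :=
  hessTerm_comm (pointMatrix_transpose hM.even_cov _ _)
    (pointMatrix_transpose (hM.even_deriv i) _ _) (pointMatrix_transpose (hM.even_deriv j) _ _) l

/-- The constant in the lower bound of the quadratic form by the Frobenius norm. -/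
noncomputable def formConst (c A : ℝ) : ℝ := 2 * c ^ 2 * (c / A ^ 2) / ((2 + 2 * A ^ 2) * A ^ 2)

lemma sum_gridHess_eq (lam : Fin p → ℝ) (x : ℕ → E d) (n : ℕ) :
    ∑ i, ∑ j, lam i * lam j * (1 / (n : ℝ) * ∑ l, gridHess ε k g v x n i j l)
      = 1 / (n : ℝ) * ∑ l, hessTerm (pointMatrix k ε (fun m : Fin n => site v m) fun m => x m)
        (pointMatrix (fun t => ∑ i, lam i * g i t) ε (fun m : Fin n => site v m) fun m => x m)
        (pointMatrix (fun t => ∑ i, lam i * g i t) ε (fun m : Fin n => site v m) fun m => x m)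
        l := by
  rw [← sum_smul_pointMatrix]
  simp_rw [hessTerm_sum]
  rw [Finset.sum_comm (s := (Finset.univ : Finset (Fin n))), Finset.mul_sum]
  refine Finset.sum_congr rfl fun i _ => ?_
  rw [Finset.sum_comm (s := (Finset.univ : Finset (Fin n))), Finset.mul_sum]
  refine Finset.sum_congr rfl fun j _ => ?_
  rw [← Finset.mul_sum, mul_left_comm]
  rfl

open Classical in
-- From each interior column `l` of the Frobenius norm only the entry at offset `u` is kept, which
-- is a local function of the perturbations.
lemma UniformBounds.sum_hessTerm_pointMatrix_ge {c A : ℝ} (hU : UniformBounds ε k g c A)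
    (hk : ∀ t, k (-t) = k t) (hk0 : k 0 = 1) {f : E d → ℝ} (hf : ∀ t, f (-t) = f t) (hf0 : f 0 = 0)
    (hv : Function.Injective v) {r : ℕ}
    (u : Window d r) {x : ℕ → E d} (hx : ∀ m, InCube (x m)) (n : ℕ) :
    formConst c A * ∑ l ∈ Finset.range n, (if Interior v r n l then
      f (latticePoint u.1 + ε • (patch v r x l u - patch v r x l (windowZero d r))) ^ 2 else 0)
      ≤ ∑ l, hessTerm (pointMatrix k ε (fun m : Fin n => site v m) fun m => x m)
        (pointMatrix f ε (fun m : Fin n => site v m) fun m => x m)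
        (pointMatrix f ε (fun m : Fin n => site v m) fun m => x m) l := by
  have hz := site_fin_injective hv n
  have hx' : ∀ m : Fin n, InCube (x m) := fun m => hx m
  have hc := hU.pos
  have hA := hU.bound_pos
  have hge := sum_hessTerm_ge hc hA
    (pointMatrix_transpose (ε := ε) hk (fun m : Fin n => site v m) fun m => x m)
    (pointMatrix_transpose (ε := ε) hf (fun m : Fin n => site v m) fun m => x m)
    (hU.opBound _ _ hz hx').1 (hU.coercive _ _ hz hx')
    (fun i => (pointMatrix_diag k _ _ i).trans hk0) (fun i => (pointMatrix_diag f _ _ i).trans hf0)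
  refine le_trans (mul_le_mul_of_nonneg_left ?_ (by unfold formConst; positivity)) hge
  rw [Finset.sum_range, Finset.sum_comm]
  refine Finset.sum_le_sum fun l _ => ?_
  by_cases hl : Interior v r n l
  · rw [if_pos hl]
    obtain ⟨m, hm, hmv⟩ := hl u
    have h1 : idx v l u = m := idx_eq hv hmv
    have h2 : idx v l (windowZero d r).1 = l := idx_eq hv (add_zero _).symm
    have h3 : pointMatrix f ε (fun m : Fin n => site v m) (fun m => x m) ⟨m, hm⟩ l
        = f (latticePoint u.1 + ε • (patch v r x l u - patch v r x l (windowZero d r))) := by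
      rw [pointMatrix_apply]
      simp only [patch, h1, h2, hmv, add_sub_cancel_left]
    rw [← h3]
    exact Finset.single_le_sum
      (f := fun a => pointMatrix f ε (fun m : Fin n => site v m) (fun m => x m) a l ^ 2)
      (fun a _ => sq_nonneg _) (Finset.mem_univ (⟨m, hm⟩ : Fin n))
  · rw [if_neg hl]
    exact Finset.sum_nonneg fun _ _ => sq_nonneg _

open Classical in
/-- The quadratic form of the averages is bounded below by averages of a local function. -/
lemma UniformBounds.form_ge {c A : ℝ} (hU : UniformBounds ε k g c A)
    (hM : RegularModel ε k g) (hv : Function.Injective v) (lam : Fin p → ℝ) {r : ℕ}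
    (u : Window d r) {x : ℕ → E d} (hx : ∀ m, InCube (x m)) (n : ℕ) :
    formConst c A * (1 / (n : ℝ) * ∑ l ∈ Finset.range n, if Interior v r n l then
      (∑ i, lam i * g i (latticePoint u.1 + ε • (patch v r x l u
        - patch v r x l (windowZero d r)))) ^ 2 else 0)
      ≤ ∑ i, ∑ j, lam i * lam j * (1 / (n : ℝ) * ∑ l, gridHess ε k g v x n i j l) := by
  rw [sum_gridHess_eq, mul_left_comm]
  refine mul_le_mul_of_nonneg_left ?_ (by positivity)
  exact hU.sum_hessTerm_pointMatrix_ge hM.even_cov hM.cov_zero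
    (f := fun t => ∑ i, lam i * g i t) (fun t => by simp only [hM.even_deriv])
    (by simp only [hM.deriv_zero, mul_zero, Finset.sum_const_zero]) hv u hx n

/-- The square of `f` at the difference of the observation points at `u` and at the centre of the
box, as a function of the perturbations in the cube. -/
noncomputable def pairSq (ε : ℝ) (f : E d → ℝ) {r : ℕ} (u : Window d r) :
    (Window d r → E d) → ℝ :=
  {y | ∀ w, InCube (y w)}.indicator fun y =>
    f (latticePoint u.1 + ε • (y u - y (windowZero d r))) ^ 2

lemma pairSq_of_inCube (f : E d → ℝ) {r : ℕ} (u : Window d r) {y : Window d r → E d}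
    (hy : ∀ w, InCube (y w)) :
    pairSq ε f u y = f (latticePoint u.1 + ε • (y u - y (windowZero d r))) ^ 2 :=
  Set.indicator_of_mem (show y ∈ {y | ∀ w, InCube (y w)} from hy) _

lemma measurable_pairSq {f : E d → ℝ} (hf : Continuous f) {r : ℕ} (u : Window d r) :
    Measurable (pairSq ε f u) :=
  (by fun_prop : Continuous fun y : Window d r → E d =>
    f (latticePoint u.1 + ε • (y u - y (windowZero d r))) ^ 2).measurable.indicator
      (measurableSet_forall_inCube r)

lemma pairSq_nonneg (f : E d → ℝ) {r : ℕ} (u : Window d r) (y : Window d r → E d) :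
    0 ≤ pairSq ε f u y :=
  Set.indicator_nonneg (fun _ _ => sq_nonneg _) y

lemma abs_pairSq_le {f : E d → ℝ} {D : ℝ} (hD : ∀ t, |f t| ≤ D) {r : ℕ} (u : Window d r)
    (y : Window d r → E d) : |pairSq ε f u y| ≤ D ^ 2 := by
  rw [abs_of_nonneg (pairSq_nonneg f u y)]
  refine Set.indicator_apply_le' (fun _ => ?_) fun _ => sq_nonneg D
  rw [← sq_abs]
  exact pow_le_pow_left₀ (abs_nonneg _) (hD _) 2

/-- If `f` is nonzero at a difference of observation points, then `pairSq` has a positive mean. -/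
lemma PerturbationLaw.integral_pairSq_pos (hL : PerturbationLaw L) {f : E d → ℝ}
    (hf : Continuous f) {D : ℝ} (hD : ∀ t, |f t| ≤ D) {r : ℕ} {u : Window d r} (hu : u.1 ≠ 0)
    {a b : E d} (ha : a ∈ L.support) (hb : b ∈ L.support)
    (hab : f (latticePoint u.1 + ε • (a - b)) ≠ 0) :
    0 < ∫ y, pairSq ε f u y ∂Measure.pi fun _ => L := by
  classical
  have := hL.isProbability
  rw [integral_pos_iff_support_of_nonneg (pairSq_nonneg f u)
    (Integrable.of_bound (measurable_pairSq hf u).aestronglyMeasurable (D ^ 2)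
      (ae_of_all _ (abs_pairSq_le hD u)))]
  have hcont : Continuous fun q : E d × E d => f (latticePoint u.1 + ε • (q.1 - q.2)) := by
    fun_prop
  have hnhds := hcont.continuousAt.eventually_ne (x := (a, b)) hab
  obtain ⟨U, V, hUo, haU, hVo, hbV, hUV⟩ := mem_nhds_prod_iff'.1 hnhds
  -- A product neighbourhood on which `f` stays nonzero. Since `u ≠ 0`, the two constrained
  -- coordinates are distinct, and each factor has positive mass because `a` and `b` lie in the
  -- support.
  let s : Window d r → Set (E d) := fun w =>
    (if w = u then U else if w = windowZero d r then V else Set.univ) ∩ {x | InCube x}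
  have hne : windowZero d r ≠ u := fun h => hu (congrArg Subtype.val h).symm
  refine lt_of_lt_of_le ?_ (measure_mono (s := Set.univ.pi s) ?_)
  · rw [Measure.pi_pi]
    refine CanonicallyOrderedAdd.prod_pos.2 fun w _ => ?_
    have hcompl : ∀ t : Set (E d), L (t ∩ {x | InCube x}) = L t := fun t =>
      measure_inter_conull (ae_iff.1 hL.ae_inCube)
    simp only [s, hcompl]
    split_ifs
    · exact (Measure.mem_support_iff_forall a).1 ha U (hUo.mem_nhds haU)
    · exact (Measure.mem_support_iff_forall b).1 hb V (hVo.mem_nhds hbV)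
    · simp
  · intro y hy
    have hcube : ∀ w, InCube (y w) := fun w => (hy w (Set.mem_univ w)).2
    have h1 : y u ∈ U := by
      have := (hy u (Set.mem_univ u)).1
      rwa [if_pos rfl] at this
    have h2 : y (windowZero d r) ∈ V := by
      have := (hy (windowZero d r) (Set.mem_univ _)).1
      rwa [if_neg hne, if_pos rfl] at this
    rw [Function.mem_support, pairSq_of_inCube f u hcube]
    exact pow_ne_zero 2 (hUV (show (y u, y (windowZero d r)) ∈ U ×ˢ V from ⟨h1, h2⟩))

lemma RegularModel.exists_bound_sum (hM : RegularModel ε k g) (lam : Fin p → ℝ) :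
    ∃ D, ∀ t, |∑ i, lam i * g i t| ≤ D := by
  obtain ⟨C, hC, -, hg⟩ := hM.exists_decay
  refine ⟨∑ i, |lam i| * C, fun t => (Finset.abs_sum_le_sum_abs _ _).trans
    (Finset.sum_le_sum fun i _ => ?_)⟩
  rw [abs_mul]
  refine mul_le_mul_of_nonneg_left ((hg i t).trans ?_) (abs_nonneg _)
  exact div_le_self hC.le (le_add_of_nonneg_right (by positivity))

/-- The limiting quadratic form is positive in the directions `lam` for which the derivative of
the covariance does not vanish on the differences of observation points. -/
theorem UniformBounds.form_pos {c A : ℝ} (hU : UniformBounds ε k g c A)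
    (hM : RegularModel ε k g) (hd : 1 ≤ d) (hv : IsGridEnumeration v)
    (hL : PerturbationLaw L) (hXm : ∀ i, Measurable (X i)) (hXind : iIndepFun X P)
    (hXlaw : ∀ i, P.map (X i) = L) {S : Matrix (Fin p) (Fin p) ℝ}
    (hS : ∀ i j, ∀ᵐ ω ∂P, Tendsto (fun n : ℕ => 1 / (n : ℝ) *
      ∑ l, gridHess ε k g v (fun m => X m ω) n i j l) atTop (𝓝 (S i j)))
    {lam : Fin p → ℝ} {u : Fin d → ℤ} (hu : u ≠ 0) {a b : E d}
    (ha : a ∈ L.support) (hb : b ∈ L.support)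
    (hab : ∑ i, lam i * g i (latticePoint u + ε • (a - b)) ≠ 0) :
    0 < ∑ i, ∑ j, lam i * lam j * S i j := by
  classical
  have := hL.isProbability
  obtain ⟨r, hr⟩ := exists_window u
  obtain ⟨D, hD⟩ := hM.exists_bound_sum lam
  have hcont : Continuous fun t => ∑ i, lam i * g i t :=
    continuous_finsetSum _ fun i _ => (hM.continuous_deriv i).const_mul (lam i)
  have hpos := hL.integral_pairSq_pos (r := r) (u := ⟨u, hr⟩) hcont hD hu ha hb hab
  have hae := ae_all_iff.2 fun i => ae_all_iff.2 fun j => hS i j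
  obtain ⟨ω, h1, h2, h3⟩ := ((ae_tendsto_localAverage hd hv hXm hXind hXlaw
    (measurable_pairSq (ε := ε) hcont (⟨u, hr⟩ : Window d r)) (abs_pairSq_le hD _)).and
    (hae.and (hL.ae_forall_inCube hXm hXlaw))).exists
  have hcc : 0 < formConst c A := by
    have := hU.pos
    have := hU.bound_pos
    unfold formConst
    positivity
  refine (mul_pos hcc hpos).trans_le ?_
  -- All limits are deterministic, so the inequality `form_ge` need only be passed to the limit
  -- along one good `ω`.
  refine le_of_tendsto_of_tendsto' (h1.const_mul (formConst c A))
    (tendsto_finsetSum _ fun i _ => tendsto_finsetSum _ fun j _ =>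
      (h2 i j).const_mul (lam i * lam j)) fun n => ?_
  refine le_of_eq_of_le ?_ (hU.form_ge hM (hv.injective hd) lam ⟨u, hr⟩ h3 n)
  congr 2
  refine Finset.sum_congr rfl fun l _ => ?_
  rw [pairSq_of_inCube (y := patch v r (fun m => X m ω) l) _ _ fun w => h3 _]

end Asymptotics

end CrossValidation

/-! ### The main theorem. -/

open CrossValidation in
theorem mainTheorem7 (d p : ℕ) (hd : 1 ≤ d)
    (θinf θsup : ℝ) (θ0 : Fin p → ℝ) (hθ0 : ∀ i, θinf < θ0 i ∧ θ0 i < θsup)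
    (K : (Fin p → ℝ) → CrossValidation.E d → ℝ)
    (hK : CrossValidation.ModelCondition d p θinf θsup K)
    (hcorr : ∀ θ ∈ CrossValidation.paramBox p θinf θsup, K θ 0 = 1)
    (v : ℕ → Fin d → ℕ) (hv : CrossValidation.IsGridEnumeration v)
    (ε : ℝ) (hε : 0 ≤ ε) (hε' : ε < 1 / 2)
    (L : Measure (CrossValidation.E d)) (hL : CrossValidation.PerturbationLaw L)
    {Ω : Type*} [MeasurableSpace Ω] (P : Measure Ω) [IsProbabilityMeasure P]
    (X : ℕ → Ω → CrossValidation.E d) (hXm : ∀ i, Measurable (X i))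
    (hXind : iIndepFun X P) (hXlaw : ∀ i, P.map (X i) = L) :
    ∃ S : Matrix (Fin p) (Fin p) ℝ,
      CrossValidation.IsSigmaCV2 P θinf θsup K v ε X θ0 S ∧
      (ε = 0 →
        (¬ ∃ lam : Fin p → ℝ, lam ≠ 0 ∧ ∀ u : Fin d → ℤ,
          CrossValidation.derivComb θinf θsup K θ0 lam (CrossValidation.latticePoint u) = 0) →
        S.PosDef) ∧
      (ε ≠ 0 →
        (¬ ∃ lam : Fin p → ℝ, lam ≠ 0 ∧
          ∀ᵐ t ∂(volume.restrict (CrossValidation.diffSet ε L.support)),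
            CrossValidation.derivComb θinf θsup K θ0 lam t = 0) →
        S.PosDef) := by
  have hprob := hL.isProbability
  have hM := ModelCondition.regularModel hθ0 hK hcorr hε hε'
  set g : Fin p → E d → ℝ := fun i t => partialDeriv θinf θsup i (fun ϑ => K ϑ t) θ0 with hg
  obtain ⟨c, A, hU⟩ := hM.exists_uniformBounds hε hε'
  choose S hS using
    hU.exists_ae_tendsto_gridHess hM hε' hd hv hL hXm hXind hXlaw
  have hsymm : ∀ i j, S i j = S j i := by
    intro i j
    obtain ⟨ω, h1, h2⟩ := ((hS i j).and (hS j i)).exists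
    simp_rw [gridHess_comm hM _ _ i j] at h1
    exact tendsto_nhds_unique h1 h2
  -- A criterion common to both regimes: each direction must be detected at one attainable
  -- difference of distinct observation points.
  have hpd : (∀ lam : Fin p → ℝ, lam ≠ 0 → ∃ u : Fin d → ℤ, u ≠ 0 ∧ ∃ a ∈ L.support,
      ∃ b ∈ L.support, ∑ i, lam i * g i (latticePoint u + ε • (a - b)) ≠ 0) →
      (Matrix.of S).PosDef := by
    intro h
    refine Matrix.PosDef.of_dotProduct_mulVec_pos ?_ fun lam hlam => ?_
    · ext i j
      simp [hsymm j i]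
    · obtain ⟨u, hu, a, ha, b, hb, hab⟩ := h lam hlam
      have hpos := hU.form_pos hM hd hv hL hXm hXind hXlaw (S := Matrix.of S) hS hu ha hb hab
      refine hpos.trans_eq ?_
      simp only [dotProduct, Matrix.mulVec, Finset.mul_sum, Matrix.of_apply, star_trivial]
      exact Finset.sum_congr rfl fun i _ => Finset.sum_congr rfl fun j _ => by ring
  refine ⟨Matrix.of S, fun i j => ?_, fun h0 hind => hpd fun lam hlam => ?_,
    fun _ hind => hpd fun lam hlam => ?_⟩
  · filter_upwards [hS i j, hL.ae_forall_inCube hXm hXlaw] with ω hω hcube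
    refine hω.congr fun n => ?_
    have hz := site_fin_injective (hv.injective hd) n
    have hx' : ∀ m : Fin n, InCube (X m ω) := fun m => hcube m
    -- The trace formula needs a nonzero diagonal of `R⁻¹`; coercivity gives it once the
    -- perturbations lie in the cube.
    have hne : ∀ l, (covMatrix K v ε (fun m => X m ω) n θ0)⁻¹ l l ≠ 0 := fun l =>
      ((div_pos hU.pos (pow_pos hU.bound_pos 2)).trans_le
        ((hU.coercive _ _ hz hx').inv_apply_ge hU.pos hU.bound_pos
          (hU.opBound _ _ hz hx').1 l)).ne'
    rw [cvHessian, trace_cvHessianOf hne]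
    rfl
  · push Not at hind
    obtain ⟨u, hu⟩ := hind lam hlam
    obtain ⟨a, ha⟩ := Measure.nonempty_support (IsProbabilityMeasure.ne_zero L)
    -- Using the same support point twice cancels the perturbation. The detecting `u` is nonzero
    -- because the derivatives vanish at the origin.
    refine ⟨u, ?_, a, ha, a, ha, ?_⟩
    · rintro rfl
      refine hu ?_
      have : (latticePoint (0 : Fin d → ℤ) : E d) = 0 := by ext; simp [latticePoint]
      rw [this, derivComb]
      exact Finset.sum_eq_zero fun i _ => by
        rw [show partialDeriv θinf θsup i (fun η => K η 0) θ0 = 0 from hM.deriv_zero i, mul_zero]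
    · rw [sub_self, smul_zero, add_zero]
      exact hu
  · by_contra! hcon
    -- If no attainable difference detects `lam`, the combination vanishes at every point of `D_ε`,
    -- hence almost everywhere on it. Its zero set is closed, so measurability of `D_ε` is not
    -- needed.
    refine hind ⟨lam, hlam, ?_⟩
    have hmeas : MeasurableSet {t | derivComb θinf θsup K θ0 lam t = 0} := by
      have hc : Continuous fun t => ∑ i, lam i * g i t :=
        continuous_finsetSum _ fun i _ => (hM.continuous_deriv i).const_mul (lam i)
      exact (isClosed_eq hc continuous_const).measurableSet
    rw [ae_restrict_iff hmeas]
    refine ae_of_all _ fun t ht => ?_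
    obtain ⟨u, hu, a, ha, b, hb, rfl⟩ := ht
    exact hcon u hu a ha b hb
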